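/- **Conventions.** For a field $K$ fix a separable closure $K_s$ and put $\mathrm{Gal}(K)=\mathrm{Gal}(K_s/K)$; for $K\subseteq L\subseteq K_s$ put $\mathrm{Gal}(L)=\mathrm{Gal}(K_s/L)\le \mathrm{Gal}(K)$. All group actions are on the left (a right action $x^g$ is the left action $g x=x^{g^{-1}}$). Profinite spaces may be empty. **Group structures.** A *group structure* $\mathbf G=(G,X,G_x)_{x\in X}$ consists of a profinite group $G$, a profinite space $X$ with a continuous action of $G$, and closed subgroups $G_x\le G$ ($x\in X$) with $G_{gx}=gG_xg^{-1}$ and $\{g\in G: gx=x\}\le G_x$ for all $g\in G$, $x\in X$, such that the map $x\mapsto G_x$ is étale continuous. Here the étale topology on the set of closed subgroups of $G$ has as a basis the sets $\{H: H\le U\}$ with $U$ an open subgroup of $G$. $\mathbf G$ is *proper* if $x\mapsto G_x$ is a homeomorphism of $X$ onto $\{G_x : x\in X\}$ with the étale topology, and *finite* if $G$ and $X$ are finite. A *morphism* $\varphi:(G,X,G_x)\to(H,Y,H_y)$ is a pair of a continuous homomorphism $\varphi:G\to H$ and a continuous map $\varphi:X\to Y$ with $\varphi(gx)=\varphi(g)\varphi(x)$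 and $\varphi(G_x)\le H_{\varphi(x)}$ for all $g\in G$, $x\in X$. It is a *cover* if $\varphi(G)=H$, $\varphi(X)=Y$, $\varphi$ maps each $G_x$ isomorphically onto $H_{\varphi(x)}$, and whenever $\varphi(x)=\varphi(x')$ there is $k\in\mathrm{Ker}(\varphi)$ with $kx=x'$. $\mathbf G$ is *projective* if for all finite group structures $\mathbf A,\mathbf B$, every morphism $\varphi:\mathbf G\to\mathbf A$ and every cover $\alpha:\mathbf B\to\mathbf A$ there is a morphism $\gamma:\mathbf G\to\mathbf B$ with $\alpha\circ\gamma=\varphi$. A *special partition* of $\mathbf G$ is a finite family $(G_i,X_i)_{i\in I_0}$ of open subgroups $G_i\le G$ and open-closed sets $X_i\subseteq X$ such that $G_x\le G_i$ for all $x\in X_i$; $G_i=\{g\in G: gX_i=X_i\}$; and there are finite sets $R_i\subseteq G$ with $G=\bigsqcup_{\rho\in R_i}\rho G_i$ for each $i\in I_0$ and $X=\bigsqcup_{i\in I_0}\bigsqcup_{\rho\in R_i}\rho X_i$ (disjoint unions). **Field-valuation structures.** A *field-valuation structure* $\mathbf K=(K,X,K_x,v_x)_{x\in X}$ consists of a field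 $K$, a profinite space $X$ with a continuous action of $\mathrm{Gal}(K)$, for each $x\in X$ a field $K\subseteq K_x\subseteq K_s$, and a valuation $v_x$ of $K_x$ (possibly trivial; equivalent valuations are identified), such that: * $\{x\in X: L\subseteq K_x\}$ is open in $X$ for each finite separable extension $L\subseteq K_s$ of $K$; $K_{\sigma x}=\sigma K_x$ for all $\sigma\in\mathrm{Gal}(K)$, $x\in X$; and $\sigma x=x$ implies $\sigma\in\mathrm{Gal}(K_x)$; * $v_{\sigma x}(\sigma u)=v_x(u)$ for all $\sigma\in\mathrm{Gal}(K)$, $x\in X$, $u\in K_x$; * for each finite separable extension $L\subseteq K_s$ of $K$ the map $x\mapsto v_x|_L$ from $\{x\in X: L\subseteq K_x\}$ to the space $\mathrm{Val}(L)$ of all valuations of $L$ is continuous, where $\mathrm{Val}(L)$ has as a subbasis the sets $\{w: w(a)>0\}$ and $\{w: w(a)\ge 0\}$, $a\in L$. Then $\mathrm{Gal}(\mathbf K)=(\mathrm{Gal}(K),X,\mathrm{Gal}(K_x))_{x\in X}$ is a group structure. $\mathbf K$ is *proper* if $\mathrm{Gal}(\mathbf K)$ is proper, and *Henselian* if each $(K_x,v_x)$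 is Henselian. **Block approximation.** A *block approximation problem* for $\mathbf K$ is a datum $(V,X_i,L_i,\mathbf a_i,c_i)_{i\in I_0}$ with $I_0$ finite, where the $L_i\subseteq K_s$ are finite separable extensions of $K$ such that $(\mathrm{Gal}(L_i),X_i)_{i\in I_0}$ is a special partition of $\mathrm{Gal}(\mathbf K)$, $V\subseteq\mathbb A^n_K$ is a smooth absolutely irreducible (i.e. geometrically integral) closed affine subvariety for some $n\ge 0$, $\mathbf a_i\in V(L_i)$, and $c_i\in K^\times$ (so $L_i\subseteq K_x$ for $x\in X_i$). A *solution* is a point $\mathbf a\in V(K)$ with $v_x(\mathbf a-\mathbf a_i)>v_x(c_i)$ for all $i\in I_0$ and $x\in X_i$, where $v_x(y_1,\dots,y_n)=\min_k v_x(y_k)$. $\mathbf K$ satisfies the *block approximation condition* if every block approximation problem for $\mathbf K$ has a solution. **Theorem.** Let $\mathbf K=(K,X,K_x,v_x)_{x\in X}$ be a proper Henselian field-valuation structure that satisfies the block approximation condition. Then its absolute Galois structure $\mathrm{Gal}(\mathbf K)=(\mathrm{Gal}(K),X,\mathrm{Gal}(K_x))_{x\in X}$ is a projective group structure. -/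

import Mathlib

open scoped Pointwise TensorProduct Topology

/-! ## Group structures

Actions are written on the left.  A right action `x ^ g` of a group is the same thing as the left
action `g • x = x ^ (g⁻¹)`; under this dictionary `x ^ g` becomes `g⁻¹ • x`, a subgroup `H ^ g`
is `g⁻¹ H g`, and a right coset `H ρ` becomes (after inversion) the left coset `ρ⁻¹ H`. -/

/-- The étale topology on the set of closed subgroups of `G`: a basis consists of the sets
`{H | H ≤ U}`, where `U` ranges over the open subgroups of `G`. -/
abbrev etaleTopology (G : Type*) [Group G] [TopologicalSpace G] :
    TopologicalSpace (ClosedSubgroup G) :=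
  TopologicalSpace.generateFrom
    {s | ∃ U : OpenSubgroup G, s = {H : ClosedSubgroup G | (H : Subgroup G) ≤ (U : Subgroup G)}}

/-- A group structure `(G, X, (G_x)_{x ∈ X})`: a profinite group `G` acting continuously on a
profinite (possibly empty) space `X`, with an étale continuous family of closed subgroups `G_x`
such that `G_{g x} = g G_x g⁻¹` and the stabilizer of `x` is contained in `G_x`. -/
structure GroupStructure (G X : Type*)
    [Group G] [TopologicalSpace G] [IsTopologicalGroup G] [CompactSpace G]
    [TotallyDisconnectedSpace G]
    [TopologicalSpace X] [CompactSpace X] [T2Space X] [TotallyDisconnectedSpace X]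
    [MulAction G X] [ContinuousSMul G X] where
  /-- the closed subgroup `G_x` -/
  sub : X → ClosedSubgroup G
  continuous_sub : Continuous[_, etaleTopology G] sub
  mem_sub_smul : ∀ (g : G) (x : X) (h : G), h ∈ sub (g • x) ↔ g⁻¹ * h * g ∈ sub x
  stabilizer_le : ∀ x : X, MulAction.stabilizer G x ≤ (sub x : Subgroup G)

namespace GroupStructure

section Basic

variable {G X H Y M Z : Type*}
  [Group G] [TopologicalSpace G] [IsTopologicalGroup G] [CompactSpace G]
  [TotallyDisconnectedSpace G]
  [TopologicalSpace X] [CompactSpace X] [T2Space X] [TotallyDisconnectedSpace X]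
  [MulAction G X] [ContinuousSMul G X]
  [Group H] [TopologicalSpace H] [IsTopologicalGroup H] [CompactSpace H]
  [TotallyDisconnectedSpace H]
  [TopologicalSpace Y] [CompactSpace Y] [T2Space Y] [TotallyDisconnectedSpace Y]
  [MulAction H Y] [ContinuousSMul H Y]
  [Group M] [TopologicalSpace M] [IsTopologicalGroup M] [CompactSpace M]
  [TotallyDisconnectedSpace M]
  [TopologicalSpace Z] [CompactSpace Z] [T2Space Z] [TotallyDisconnectedSpace Z]
  [MulAction M Z] [ContinuousSMul M Z]

/-- A group structure is proper if `x ↦ G_x` is a homeomorphism of `X` onto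
`{G_x | x ∈ X}` equipped with the étale topology. -/
def IsProper (𝓖 : GroupStructure G X) : Prop :=
  @Topology.IsEmbedding X (ClosedSubgroup G) _ (etaleTopology G) 𝓖.sub

/-- A morphism of group structures. -/
@[ext]
structure Hom (𝓖 : GroupStructure G X) (𝓗 : GroupStructure H Y) where
  /-- the continuous homomorphism of groups -/
  onGroup : G →ₜ* H
  /-- the continuous map of spaces -/
  onSpace : C(X, Y)
  map_smul : ∀ (g : G) (x : X), onSpace (g • x) = onGroup g • onSpace x
  map_sub : ∀ (x : X), ∀ g ∈ 𝓖.sub x, onGroup g ∈ 𝓗.sub (onSpace x)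

/-- Composition of morphisms of group structures. -/
def Hom.comp {𝓖 : GroupStructure G X} {𝓗 : GroupStructure H Y} {𝓜 : GroupStructure M Z}
    (ψ : Hom 𝓗 𝓜) (φ : Hom 𝓖 𝓗) : Hom 𝓖 𝓜 where
  onGroup := ψ.onGroup.comp φ.onGroup
  onSpace := ψ.onSpace.comp φ.onSpace
  map_smul g x := by simp [φ.map_smul, ψ.map_smul]
  map_sub x g hg := ψ.map_sub _ _ (φ.map_sub x g hg)

/-- A cover of group structures: an epimorphism that maps each `G_x` isomorphically onto
`H_{φ x}` and whose fibers on the spaces are contained in orbits of the kernel.  (Since every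
`G_x` is compact, a bijective continuous homomorphism `G_x → H_{φ x}` is an isomorphism of
profinite groups.) -/
structure Hom.IsCover {𝓖 : GroupStructure G X} {𝓗 : GroupStructure H Y} (φ : Hom 𝓖 𝓗) :
    Prop where
  surjective_group : Function.Surjective φ.onGroup
  surjective_space : Function.Surjective φ.onSpace
  bijOn : ∀ x : X, Set.BijOn φ.onGroup (𝓖.sub x : Set G) (𝓗.sub (φ.onSpace x) : Set H)
  exists_smul_eq : ∀ x x' : X, φ.onSpace x = φ.onSpace x' →
    ∃ k : G, φ.onGroup k = 1 ∧ k • x = x'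

/-- A special partition `(G_i, X_i)_{i ∈ ι}` of a group structure: a finite family of clopen sets
`X_i` and open subgroups `G_i` such that `G_i` contains `G_x` for `x ∈ X_i`, `G_i` is the setwise
stabilizer of `X_i`, and there are finite sets `R_i ⊆ G` such that `G` is the disjoint union of
the cosets `ρ G_i`, `ρ ∈ R_i`, for each `i`, and `X` is the disjoint union of the sets `ρ X_i`,
`i ∈ ι`, `ρ ∈ R_i`. -/
structure IsSpecialPartition (𝓖 : GroupStructure G X) {ι : Type*} [Finite ι]
    (S : ι → Subgroup G) (B : ι → Set X) : Prop where
  isClopen : ∀ i, IsClopen (B i)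
  isOpen : ∀ i, IsOpen (S i : Set G)
  sub_le : ∀ i, ∀ x ∈ B i, (𝓖.sub x : Subgroup G) ≤ S i
  eq_stabilizer : ∀ i, S i = MulAction.stabilizer G (B i)
  exists_transversals : ∃ R : ι → Finset G,
    (∀ i, (⋃ ρ ∈ R i, ρ • (S i : Set G)) = Set.univ ∧
      (R i : Set G).PairwiseDisjoint fun ρ => ρ • (S i : Set G)) ∧
    (⋃ i, ⋃ ρ ∈ R i, ρ • B i) = Set.univ ∧
    {p : ι × G | p.2 ∈ R p.1}.PairwiseDisjoint fun p => p.2 • B p.1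

/-- A group structure `𝓖` is projective if every finite embedding problem
`(φ : 𝓖 → 𝓐, α : 𝓑 → 𝓐)` for it, where `𝓐` and `𝓑` are finite group structures and `α` is a
cover, has a solution, i.e. a morphism `γ : 𝓖 → 𝓑` with `α ∘ γ = φ`.
(Finite profinite groups and spaces are discrete; every finite group structure is isomorphic to
one whose underlying group and space lie in `Type`.) -/
def IsProjective (𝓖 : GroupStructure G X) : Prop :=
  ∀ (A I B J : Type)
    [Group A] [Finite A] [TopologicalSpace A] [DiscreteTopology A]
    [Finite I] [TopologicalSpace I] [DiscreteTopology I] [MulAction A I] [ContinuousSMul A I]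
    [Group B] [Finite B] [TopologicalSpace B] [DiscreteTopology B]
    [Finite J] [TopologicalSpace J] [DiscreteTopology J] [MulAction B J] [ContinuousSMul B J]
    (𝓐 : GroupStructure A I) (𝓑 : GroupStructure B J)
    (φ : Hom 𝓖 𝓐) (α : Hom 𝓑 𝓐), α.IsCover → ∃ γ : Hom 𝓖 𝓑, α.comp γ = φ

end Basic

end GroupStructure

/-! ## Field structures -/

/-- A field structure `(K, X, (K_x)_{x ∈ X})`: a field `K` with separable closure `Ks`, a
profinite space `X` with a continuous action of the absolute Galois group of `K`, and an étale
continuous family of separable algebraic extensions `K_x` of `K`, such that `K_{σ x} = σ K_x` and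
the stabilizer of `x` is contained in `Gal(Ks / K_x)`. -/
structure FieldStructure (K Ks X : Type*) [Field K] [Field Ks] [Algebra K Ks] [IsSepClosure K Ks]
    [TopologicalSpace X] [CompactSpace X] [T2Space X] [TotallyDisconnectedSpace X]
    [MulAction (Ks ≃ₐ[K] Ks) X] [ContinuousSMul (Ks ≃ₐ[K] Ks) X] where
  /-- the local field `K_x` -/
  field : X → IntermediateField K Ks
  isOpen_setOf_le : ∀ L : IntermediateField K Ks, FiniteDimensional K L →
    IsOpen {x : X | L ≤ field x}
  field_smul : ∀ (σ : Ks ≃ₐ[K] Ks) (x : X),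
    field (σ • x) = (field x).map (σ : Ks →ₐ[K] Ks)
  stabilizer_le : ∀ x : X, MulAction.stabilizer (Ks ≃ₐ[K] Ks) x ≤ (field x).fixingSubgroup

namespace FieldStructure

variable {K Ks X : Type*} [Field K] [Field Ks] [Algebra K Ks] [IsSepClosure K Ks]
  [TopologicalSpace X] [CompactSpace X] [T2Space X] [TotallyDisconnectedSpace X]
  [MulAction (Ks ≃ₐ[K] Ks) X] [ContinuousSMul (Ks ≃ₐ[K] Ks) X]

/-- The absolute Galois structure `Gal(𝓚) = (Gal(K), X, (Gal(K_x))_{x ∈ X})`. -/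
def gal (𝓚 : FieldStructure K Ks X) : GroupStructure (Ks ≃ₐ[K] Ks) X where
  sub x := ⟨(𝓚.field x).fixingSubgroup, InfiniteGalois.fixingSubgroup_isClosed _⟩
  continuous_sub := by
    refine continuous_generateFrom_iff.2 ?_
    rintro _ ⟨U, rfl⟩
    have hU : (IntermediateField.fixedField (U : Subgroup (Ks ≃ₐ[K] Ks))).fixingSubgroup = U :=
      InfiniteGalois.fixingSubgroup_fixedField ⟨(U : Subgroup (Ks ≃ₐ[K] Ks)), U.isClosed⟩
    have hfin : FiniteDimensional K
        (IntermediateField.fixedField (U : Subgroup (Ks ≃ₐ[K] Ks))) := by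
      refine (InfiniteGalois.isOpen_iff_finite _).1 ?_
      change IsOpen ((IntermediateField.fixedField
        (U : Subgroup (Ks ≃ₐ[K] Ks))).fixingSubgroup : Set (Ks ≃ₐ[K] Ks))
      rw [hU]
      exact U.isOpen
    convert 𝓚.isOpen_setOf_le _ hfin using 1
    ext x
    change (𝓚.field x).fixingSubgroup ≤ (U : Subgroup (Ks ≃ₐ[K] Ks)) ↔ _
    constructor
    · intro h
      have := IntermediateField.fixedField_antitone h
      rwa [InfiniteGalois.fixedField_fixingSubgroup] at this
    · intro h
      rw [← hU]
      exact IntermediateField.fixingSubgroup_antitone h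
  mem_sub_smul σ x τ := by
    change τ ∈ (𝓚.field (σ • x)).fixingSubgroup ↔ σ⁻¹ * τ * σ ∈ (𝓚.field x).fixingSubgroup
    rw [𝓚.field_smul, IntermediateField.mem_fixingSubgroup_iff,
      IntermediateField.mem_fixingSubgroup_iff]
    constructor
    · intro h u hu
      have h1 : τ (σ u) = σ u := h (σ u) ⟨u, hu, rfl⟩
      change σ⁻¹ (τ (σ u)) = u
      rw [h1]
      exact σ.symm_apply_apply u
    · rintro h _ ⟨u, hu, rfl⟩
      have h1 : σ⁻¹ (τ (σ u)) = u := h u hu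
      change τ (σ u) = σ u
      conv_rhs => rw [← h1]
      exact (σ.apply_symm_apply _).symm
  stabilizer_le := 𝓚.stabilizer_le

end FieldStructure

/-! ## Field-valuation structures

Equivalent valuations of a field are identified, so a valuation is given by its valuation ring
`O`; its value `v(a)` is `O.valuation a`, written multiplicatively: `v(a) ≥ 0` reads
`O.valuation a ≤ 1`, and `v(a) > v(c)` reads `O.valuation a < O.valuation c`.
The trivial valuation, with `O = ⊤`, is allowed. -/

/-- The patch topology on the space `Val(F)` of all valuations of `F`. -/
abbrev patchTopology (F : Type*) [Field F] : TopologicalSpace (ValuationSubring F) :=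
  TopologicalSpace.generateFrom
    {s | ∃ a : F, s = {w : ValuationSubring F | w.valuation a < 1} ∨
      s = {w : ValuationSubring F | w.valuation a ≤ 1}}

/-- A field-valuation structure `(K, X, (K_x, v_x)_{x ∈ X})`: a field structure together with a
valuation `v_x` of each `K_x` such that `v_{σ x}(σ u) = v_x(u)` and, for each finite separable
extension `L` of `K`, the map `x ↦ v_x|_L` from `{x | L ⊆ K_x}` to `Val(L)` is continuous. -/
structure FieldValuationStructure (K Ks X : Type*)
    [Field K] [Field Ks] [Algebra K Ks] [IsSepClosure K Ks]
    [TopologicalSpace X] [CompactSpace X] [T2Space X] [TotallyDisconnectedSpace X]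
    [MulAction (Ks ≃ₐ[K] Ks) X] [ContinuousSMul (Ks ≃ₐ[K] Ks) X]
    extends FieldStructure K Ks X where
  /-- the (valuation ring of the) valuation `v_x` of `K_x` -/
  val : ∀ x : X, ValuationSubring (field x)
  val_smul : ∀ (σ : Ks ≃ₐ[K] Ks) (x : X) (u : Ks) (hu : u ∈ field x)
    (hσu : σ u ∈ field (σ • x)),
    (⟨σ u, hσu⟩ : field (σ • x)) ∈ val (σ • x) ↔ (⟨u, hu⟩ : field x) ∈ val x
  continuous_val : ∀ L : IntermediateField K Ks, FiniteDimensional K L →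
    Continuous[_, patchTopology L] fun x : {x : X // L ≤ field x} =>
      (val x.1).comap (IntermediateField.inclusion x.2 : L →ₐ[K] field x.1).toRingHom

/-- The ideal `I` of `K[T_1, …, T_n]` defines a smooth absolutely irreducible affine variety
`V ⊆ 𝔸ⁿ` over `K`: its coordinate ring is a smooth `K`-algebra and stays an integral domain after
base change to an algebraic closure of `K`. -/
structure IsSmoothAbsIrredVariety (K : Type*) [Field K] {n : ℕ}
    (I : Ideal (MvPolynomial (Fin n) K)) : Prop where
  smooth : Algebra.Smooth K (MvPolynomial (Fin n) K ⧸ I)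
  isDomain : IsDomain (AlgebraicClosure K ⊗[K] (MvPolynomial (Fin n) K ⧸ I))

/-- `a ∈ V(F)`, where `V` is the closed subscheme of affine space defined by `I`. -/
def IsRationalPoint {K F : Type*} [Field K] [Field F] [Algebra K F] {n : ℕ}
    (I : Ideal (MvPolynomial (Fin n) K)) (a : Fin n → F) : Prop :=
  ∀ f ∈ I, MvPolynomial.aeval a f = 0

namespace FieldValuationStructure

variable {K Ks X : Type*} [Field K] [Field Ks] [Algebra K Ks] [IsSepClosure K Ks]
  [TopologicalSpace X] [CompactSpace X] [T2Space X] [TotallyDisconnectedSpace X]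
  [MulAction (Ks ≃ₐ[K] Ks) X] [ContinuousSMul (Ks ≃ₐ[K] Ks) X]

/-- `𝓚` is proper if its absolute Galois structure is proper. -/
def IsProper (𝓚 : FieldValuationStructure K Ks X) : Prop :=
  𝓚.gal.IsProper

/-- `𝓚` is Henselian if every valued field `(K_x, v_x)` is Henselian. -/
def IsHenselian (𝓚 : FieldValuationStructure K Ks X) : Prop :=
  ∀ x : X, HenselianLocalRing (𝓚.val x)

/-- A block approximation problem `(V, X_i, L_i, a_i, c_i)_{i ∈ ι}` for `𝓚`. -/
structure BlockApproximationProblem (𝓚 : FieldValuationStructure K Ks X)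
    (ι : Type) [Finite ι] where
  /-- the dimension of the ambient affine space -/
  n : ℕ
  /-- the ideal of polynomials vanishing on the variety `V ⊆ 𝔸ⁿ` -/
  V : Ideal (MvPolynomial (Fin n) K)
  /-- the blocks `X_i` -/
  block : ι → Set X
  /-- the finite separable extensions `L_i` of `K` -/
  L : ι → IntermediateField K Ks
  /-- the points `a_i ∈ V(L_i)` -/
  point : ∀ i, Fin n → L i
  /-- the elements `c_i ∈ K^×` -/
  c : ι → Kˣ
  finite_L : ∀ i, FiniteDimensional K (L i)
  isSpecialPartition : 𝓚.gal.IsSpecialPartition (fun i => (L i).fixingSubgroup) block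
  isVariety : IsSmoothAbsIrredVariety K V
  isRationalPoint : ∀ i, IsRationalPoint V (point i)

/-- `L_i ⊆ K_x` for `x ∈ X_i`. -/
theorem BlockApproximationProblem.L_le {𝓚 : FieldValuationStructure K Ks X} {ι : Type}
    [Finite ι] (P : 𝓚.BlockApproximationProblem ι) {i : ι} {x : X} (hx : x ∈ P.block i) :
    P.L i ≤ 𝓚.field x := by
  have h : (𝓚.field x).fixingSubgroup ≤ (P.L i).fixingSubgroup :=
    P.isSpecialPartition.sub_le i x hx
  have := IntermediateField.fixedField_antitone h
  rwa [InfiniteGalois.fixedField_fixingSubgroup, InfiniteGalois.fixedField_fixingSubgroup] at this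

/-- A solution of a block approximation problem: a point `a ∈ V(K)` such that
`v_x(a - a_i) > v_x(c_i)` for all `i` and all `x ∈ X_i`.  Here `v_x` of a vector is the minimum
of the values of its coordinates. -/
def BlockApproximationProblem.IsSolution {𝓚 : FieldValuationStructure K Ks X} {ι : Type}
    [Finite ι] (P : 𝓚.BlockApproximationProblem ι) (a : Fin P.n → K) : Prop :=
  IsRationalPoint P.V a ∧
    ∀ (i : ι) (x : X) (hx : x ∈ P.block i) (k : Fin P.n),
      (𝓚.val x).valuation
          (algebraMap K (𝓚.field x) (a k) - IntermediateField.inclusion (P.L_le hx) (P.point i k))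
        < (𝓚.val x).valuation (algebraMap K (𝓚.field x) (P.c i))

/-- The block approximation condition: every block approximation problem has a solution. -/
def BlockApproximationCondition (𝓚 : FieldValuationStructure K Ks X) : Prop :=
  ∀ (ι : Type) [Finite ι] (P : 𝓚.BlockApproximationProblem ι), ∃ a, P.IsSolution a

end FieldValuationStructure

/-!
# Projectivity from block approximation

Let `φ : Gal(𝓚) → 𝓐` be a morphism and `α : 𝓑 → 𝓐` a cover of finite group structures, let `B` be
the preimage under `α` of the image of `φ`, and let `L` be the fixed field of the kernel of `φ`, so
that `α` induces an epimorphism `π : B → Gal(L / K)`.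

**The variety.** Functions `t : B → L` that generate a normal basis, i.e. with
`det (t (b * e)) ≠ 0`, are the `L`-points of an affine open subset of affine space over `L`; `B`
acts semilinearly and freely on its coordinate ring `R` (`TorsorRing`). The ring of invariants
`S = R ^ B` is smooth and geometrically integral over `K`
(`NormalBasisAlgebra.smooth`, `TorsorRing.isDomain_tensorProduct_fixedPoints`). It classifies
homomorphisms from Galois groups to `B` that lift the restriction to `L`: a point `S → K` lifts to
`p : R → Ks`, and `σ ∘ p = p ∘ γ σ` defines `γ : Gal(K) → B`
(`TorsorRing.exists_point_of_rational`). Conversely, by the normal basis theorem every such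
homomorphism on an open subgroup comes from a point of `S` over the fixed field
(`TorsorRing.exists_point_of_hom`).

**Local solutions.** Since `α` maps each `B_j` isomorphically onto `A_i`, the map `φ` has for each
`x` a lift `γ_x` to an open subgroup `U_x` that contains `G_x`. By properness `G_x` is the
stabilizer of `x`, and compactness gives a special partition whose groups are contained in such
`U_x` (`GroupStructure.IsProper.exists_isSpecialPartition`). The points of `S` that belong to the
`γ_x` form a block approximation problem.

**Krasner's lemma.** A solution of this problem gives `γ : Gal(K) → B` and a point `p` that is close
to the local points `p_x`. Dual families provide a function `comparison` on `B` which, when `p` and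
`p_x` lie over the same point of `S`, is the indicator function of an element conjugating `γ` to
`γ_x`. In general `p` and `p_x` are only close for the extension of the Henselian valuation to `Ks`,
and then exactly one value of the comparison function on the kernel of `π` is close to `1`
(`NormalBasisAlgebra.exists_finset_existsUnique_comparison`). The extension of the valuation is
unique, hence invariant under the decomposition group, so this distinguished element is canonical and conjugates
`γ` to `γ_x` on `G_y` for all `y` in the block; it is locally constant in `y`. With these elements
the chosen points of `𝓑` are spread over `X`, which turns `γ` into a morphism
(`GroupStructure.exists_hom_of_blocks`).

The extension of valuations is proved directly: the integral closure of a Henselian valuation ring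
in a Galois extension is a valuation ring (`henselianExtension`). So is smoothness of `S`:
formal smoothness descends from `R` to `S` because `R` is finite étale over `S` with an `S`-linear
retraction (`Algebra.FormallySmooth.of_etale_of_retraction`).
-/

/-! ### Extension of Henselian valuations -/

section Henselian

open Polynomial

/-- Seidenberg's lemma: in a field that contains an integrally closed local domain `D`, a root `z`
of a polynomial over `D` with a unit coefficient lies in `D`, or its inverse does. -/
theorem mem_or_inv_mem_of_aeval_eq_zero {D F : Type*} [CommRing D] [IsLocalRing D] [Field F]
    [Algebra D F] [FaithfulSMul D F]
    (hD : ∀ z : F, IsIntegral D z → z ∈ (algebraMap D F).range) :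
    ∀ (n : ℕ) (a : ℕ → D) (z : F), z ≠ 0 →
      ∑ i ∈ Finset.range (n + 1), algebraMap D F (a i) * z ^ i = 0 →
      (∃ i ≤ n, IsUnit (a i)) → z ∈ (algebraMap D F).range ∨ z⁻¹ ∈ (algebraMap D F).range := by
  intro n
  induction n with
  | zero =>
    rintro a z hz h ⟨i, hi, hu⟩
    obtain rfl : i = 0 := by omega
    exfalso
    simp at h
    exact (hu.map (algebraMap D F)).ne_zero (by simp [h])
  | succ n ih =>
    rintro a z hz h ⟨i, hi, hu⟩
    -- the product of the leading coefficient and `z` is integral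
    have hint : IsIntegral D (algebraMap D F (a (n + 1)) * z) := by
      set c := a (n + 1)
      refine ⟨X ^ (n + 1) + ∑ i ∈ Finset.range (n + 1), C (a i * c ^ (n - i)) * X ^ i, ?_, ?_⟩
      · refine monic_X_pow_add (lt_of_le_of_lt (degree_sum_le _ _) ?_)
        rw [Finset.sup_lt_iff (by exact WithBot.bot_lt_coe _)]
        intro j hj
        refine (degree_C_mul_X_pow_le _ _).trans_lt ?_
        exact_mod_cast Finset.mem_range.1 hj
      · rw [Finset.sum_range_succ] at h
        have h2 : algebraMap D F c ^ n * (∑ x ∈ Finset.range (n + 1), algebraMap D F (a x) * z ^ x +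
            algebraMap D F c * z ^ (n + 1)) = 0 := by
          rw [h, mul_zero]
        simp only [eval₂_add, eval₂_X, eval₂_finsetSum, eval₂_mul, eval₂_C, eval₂_pow, map_mul,
          map_pow]
        rw [← h2, mul_add, Finset.mul_sum, add_comm]
        congr 1
        · refine Finset.sum_congr rfl fun j hj => ?_
          have : algebraMap D F c ^ n = algebraMap D F c ^ (n - j) * algebraMap D F c ^ j := by
            rw [← pow_add]
            congr 1
            have := Finset.mem_range.1 hj
            omega
          rw [this]
          ring
        · ring
    obtain ⟨b, hb⟩ := hD _ hint
    by_cases hlead : IsUnit (a (n + 1))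
    · left
      obtain ⟨v, hv⟩ := hlead.exists_left_inv
      refine ⟨v * b, ?_⟩
      rw [map_mul, hb, ← mul_assoc, ← map_mul, hv, map_one, one_mul]
    by_cases hbu : IsUnit b
    · right
      obtain ⟨v, hv⟩ := hbu.exists_left_inv
      refine ⟨v * a (n + 1), ?_⟩
      have h1 : algebraMap D F v * algebraMap D F b = 1 := by rw [← map_mul, hv, map_one]
      rw [map_mul]
      rw [hb] at h1
      exact eq_inv_of_mul_eq_one_left (by linear_combination h1)
    -- absorb the leading term into the previous coefficient
    refine ih (Function.update a n (a n + b)) z hz ?_ ?_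
    · rw [Finset.sum_range_succ, Finset.sum_congr rfl (g := fun i => algebraMap D F (a i) * z ^ i)]
      · rw [Finset.sum_range_succ, Finset.sum_range_succ] at h
        simp only [Function.update_self, map_add, hb]
        linear_combination h
      · intro j hj
        rw [Function.update_of_ne (by have := Finset.mem_range.1 hj; omega)]
    · have hi' : i ≤ n := by
        rcases Nat.lt_or_ge n i with h' | h'
        · exact absurd (by rwa [show n + 1 = i by omega]) hlead
        · exact h'
      refine ⟨i, hi', ?_⟩
      by_cases hin : i = n
      · subst hin
        rw [Function.update_self]
        by_contra hcon
        have := IsLocalRing.nonunits_add (a := a i + b) (b := -b) hcon (by simpa using hbu)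
        simp at this
        exact this hu
      · rwa [Function.update_of_ne hin]

/-- A domain with an action of a finite group whose ring of invariants is Henselian is local:
otherwise there is an element congruent to `1` modulo one maximal ideal and to `0` modulo its other
conjugates, and Hensel's lemma for the polynomial of its conjugates makes it invariant. -/
theorem isLocalRing_of_isInvariant_of_henselian {O D G : Type*} [CommRing O] [CommRing D]
    [IsDomain D] [Algebra O D] [Group G] [Finite G] [MulSemiringAction G D] [SMulCommClass G O D]
    [Algebra.IsInvariant O D G] [HenselianLocalRing O] : IsLocalRing D := by
  classical
  cases nonempty_fintype G
  have hint : Algebra.IsIntegral O D := Algebra.IsInvariant.isIntegral O D G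
  have hunder : ∀ Q : Ideal D, Q.IsMaximal → Q.under O = IsLocalRing.maximalIdeal O := by
    intro Q hQ
    have := Ideal.isMaximal_comap_of_isIntegral_of_isMaximal (R := O) Q
    exact IsLocalRing.eq_maximalIdeal this
  have key : ∀ P Q : Ideal D, P.IsMaximal → Q.IsMaximal → P = Q := by
    intro P Q hP hQ
    by_contra hne
    obtain ⟨τ, rfl⟩ := Algebra.IsInvariant.exists_smul_of_under_eq O D G P Q
      ((hunder P hP).trans (hunder Q hQ).symm)
    have hsmulmax : ∀ g : G, (g • P).IsMaximal := fun g => by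
      have : g • P = P.comap (MulSemiringAction.toRingEquiv G D g⁻¹ : D →+* D) := by
        ext x
        simp [Ideal.mem_pointwise_smul_iff_inv_smul_mem]
      rw [this]
      exact Ideal.comap_isMaximal_of_equiv (MulSemiringAction.toRingEquiv G D g⁻¹)
    -- an element that is congruent to `1` modulo `P` and lies in all other conjugates of `P`
    obtain ⟨u₁, hu₁P, hu₁⟩ : ∃ u₁ : D, u₁ ∉ P ∧ ∀ g : G, g • P ≠ P → u₁ ∈ g • P := by
      by_contra! hcon
      have hle : (Finset.univ.filter fun g : G => g • P ≠ P).inf (fun g => g • P) ≤ P := by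
        intro x hx
        by_contra hxP
        obtain ⟨g, hg, hxg⟩ := hcon x hxP
        rw [Submodule.mem_finsetInf] at hx
        exact hxg (hx g (by simpa using hg))
      obtain ⟨g, hg, hgP⟩ := (Ideal.IsPrime.inf_le' hP.isPrime).1 hle
      exact (Finset.mem_filter.1 hg).2 ((hsmulmax g).eq_of_le hP.ne_top hgP)
    obtain ⟨v, hv⟩ : ∃ v : D, u₁ * v - 1 ∈ P := by
      obtain ⟨v, hv⟩ := hP.exists_inv hu₁P
      obtain ⟨i, hi, h⟩ := hv
      exact ⟨v, by rw [← h]; ring_nf; exact P.neg_mem hi⟩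
    set u₀ := u₁ * v with hu₀
    let H := MulAction.stabilizer G P
    set u : D := ∏ h : H, (h : G) • u₀ with hu
    have hu_one : Ideal.Quotient.mk P u = 1 := by
      rw [hu, map_prod]
      refine Finset.prod_eq_one fun h _ => ?_
      rw [← map_one (Ideal.Quotient.mk P), Ideal.Quotient.eq]
      have : (h : G) • (u₀ - 1) ∈ (h : G) • P := Ideal.smul_mem_pointwise_smul _ _ _ hv
      rw [smul_sub, smul_one] at this
      rwa [show (h : G) • P = P from h.2] at this
    have hu_mem : ∀ g : G, g • P ≠ P → u ∈ g • P := by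
      intro g hg
      rw [hu, ← Finset.mul_prod_erase _ _ (Finset.mem_univ (1 : H))]
      refine Ideal.mul_mem_right _ _ ?_
      simpa using Ideal.mul_mem_right v _ (hu₁ g hg)
    have hu_inv : ∀ h : G, h • P = P → h • u = u := by
      intro h hh
      rw [hu, Finset.smul_prod']
      refine Fintype.prod_equiv (Equiv.mulLeft (⟨h, hh⟩ : H)) _ _ fun x => ?_
      rw [smul_smul]
      rfl
    -- the conjugates of `u` other than `u` itself lie in `P`
    have hconj : ∀ g : G, g • u ≠ u → g • u ∈ P := by
      intro g hg
      have h1 : g⁻¹ • P ≠ P := fun h => hg <| hu_inv g <| by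
        rw [inv_smul_eq_iff] at h; exact h.symm
      have := Ideal.smul_mem_pointwise_smul g _ _ (hu_mem _ h1)
      rwa [smul_inv_smul] at this
    let f : D[X] := ∏ w ∈ Finset.univ.image (fun g : G => g • u), (X - C w)
    have hfmonic : f.Monic := monic_prod_of_monic _ _ fun w _ => monic_X_sub_C w
    have hfinv : ∀ g : G, g • f = f := by
      intro g
      simp only [f]
      rw [Finset.smul_prod']
      refine Finset.prod_bij (fun w _ => g • w) ?_ ?_ ?_ ?_
      · intro w hw
        obtain ⟨x, -, rfl⟩ := Finset.mem_image.1 hw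
        exact Finset.mem_image.2 ⟨g * x, Finset.mem_univ _, mul_smul _ _ _⟩
      · intro a _ b _ h
        exact MulAction.injective g h
      · intro w hw
        obtain ⟨x, -, rfl⟩ := Finset.mem_image.1 hw
        exact ⟨(g⁻¹ * x) • u, Finset.mem_image.2 ⟨_, Finset.mem_univ _, rfl⟩, by simp [smul_smul]⟩
      · intro a _
        simp [smul_sub]
    have hflift : f ∈ lifts (algebraMap O D) := by
      rw [lifts_iff_coeff_lifts]
      intro n
      obtain ⟨a, ha⟩ := Algebra.IsInvariant.isInvariant (A := O) (G := G) (f.coeff n) fun g => by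
        conv_rhs => rw [← hfinv g]
        rw [Polynomial.smul_eq_map, coeff_map]
        rfl
      exact ⟨a, ha⟩
    obtain ⟨q, hqf, -, hqmonic⟩ := lifts_and_degree_eq_and_monic hflift hfmonic
    -- modulo `P` the polynomial `f` is `(X - 1) X ^ r`
    have hfP : ∃ r, f.map (Ideal.Quotient.mk P) = (X - 1) * X ^ r := by
      refine ⟨((Finset.univ.image (fun g : G => g • u)).erase u).card, ?_⟩
      simp only [f, Polynomial.map_prod]
      have hmem : u ∈ Finset.univ.image (fun g : G => g • u) :=
        Finset.mem_image.2 ⟨1, Finset.mem_univ _, one_smul _ _⟩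
      rw [← Finset.mul_prod_erase _ _ hmem]
      congr 1
      · simp [hu_one]
      · refine Finset.prod_eq_pow_card fun w hw => ?_
        obtain ⟨hwu, hw⟩ := Finset.mem_erase.1 hw
        obtain ⟨g, -, rfl⟩ := Finset.mem_image.1 hw
        have : Ideal.Quotient.mk P (g • u) = 0 := Ideal.Quotient.eq_zero_iff_mem.2 (hconj g hwu)
        simp [this]
    obtain ⟨r, hr⟩ := hfP
    have hmk : ∀ (p : O[X]) (a : O), Ideal.Quotient.mk P (algebraMap O D (p.eval a)) =
        ((p.map (algebraMap O D)).map (Ideal.Quotient.mk P)).eval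
          (Ideal.Quotient.mk P (algebraMap O D a)) := by
      intro p a
      rw [eval_map_apply, eval_map_apply]
    have hmemP : ∀ a : O, a ∈ IsLocalRing.maximalIdeal O ↔
        Ideal.Quotient.mk P (algebraMap O D a) = 0 := by
      intro a
      rw [Ideal.Quotient.eq_zero_iff_mem, ← hunder P hP]
      rfl
    have h1 : q.eval 1 ∈ IsLocalRing.maximalIdeal O := by
      rw [hmemP, hmk, hqf, hr]
      simp
    have h2 : IsUnit (q.derivative.eval 1) := by
      rw [← not_not (a := IsUnit _), ← mem_nonunits_iff, ← IsLocalRing.mem_maximalIdeal, hmemP,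
        hmk, ← derivative_map, ← derivative_map, hqf, hr]
      simp
    obtain ⟨a, ha, ha1⟩ := HenselianLocalRing.is_henselian q hqmonic 1 h1 h2
    have hfa : f.eval (algebraMap O D a) = 0 := by
      rw [← hqf, eval_map_apply, ha.eq_zero, map_zero]
    simp only [f, eval_prod, Finset.prod_eq_zero_iff] at hfa
    obtain ⟨w, hw, hwa⟩ := hfa
    obtain ⟨g, -, rfl⟩ := Finset.mem_image.1 hw
    have hua : u = algebraMap O D a := by
      rw [eval_sub, eval_X, eval_C, sub_eq_zero, ← inv_smul_eq_iff, smul_algebraMap] at hwa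
      exact hwa.symm
    have h3 : a ∈ (τ • P).under O := by
      change algebraMap O D a ∈ τ • P
      rw [← hua]
      exact hu_mem τ fun h => hne h.symm
    rw [hunder _ hQ] at h3
    have h4 := Ideal.sub_mem _ h3 ha1
    rw [sub_sub_cancel] at h4
    exact (Ideal.ne_top_iff_one _).1 (IsLocalRing.maximalIdeal.isMaximal O).ne_top h4
  obtain ⟨P, hP⟩ := Ideal.exists_maximal D
  exact IsLocalRing.of_unique_max_ideal ⟨P, hP, fun Q hQ => key _ _ hQ hP⟩

/-- The integral closure of a Henselian valuation ring in a finite Galois extension is a valuation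
ring. -/
theorem isIntegral_or_isIntegral_inv_of_finiteDimensional {k F : Type*} [Field k] [Field F]
    [Algebra k F] [FiniteDimensional k F] [IsGalois k F] (O : ValuationSubring k)
    [HenselianLocalRing O] (z : F) : IsIntegral O z ∨ IsIntegral O z⁻¹ := by
  rcases eq_or_ne z 0 with rfl | hz
  · exact Or.inl isIntegral_zero
  let D := integralClosure O F
  have : IsFractionRing D F := integralClosure.isFractionRing_of_finite_extension k F
  let _ : MulSemiringAction Gal(F/k) D := IsIntegralClosure.MulSemiringAction O k F D
  have : Algebra.IsInvariant O D Gal(F/k) := Algebra.isInvariant_of_isGalois O k F D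
  have : SMulCommClass Gal(F/k) O D := ⟨fun g o d => map_smul (galRestrict O k F D g) o d⟩
  have hloc : IsLocalRing D := isLocalRing_of_isInvariant_of_henselian (O := O) (G := Gal(F/k))
  have hrange : ∀ z : F, z ∈ (algebraMap D F).range ↔ IsIntegral O z := by
    intro z
    exact ⟨by rintro ⟨d, rfl⟩; exact d.2, fun h => ⟨⟨z, h⟩, rfl⟩⟩
  -- a primitive polynomial over `O` with root `z`
  obtain ⟨p, hp0, hp⟩ := Algebra.IsAlgebraic.isAlgebraic (R := k) z
  obtain ⟨j, hj, hmax⟩ := p.support.exists_max_image (fun i => O.valuation (p.coeff i))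
    (nonempty_support_iff.2 hp0)
  have hj0 : p.coeff j ≠ 0 := mem_support_iff.1 hj
  have hle : ∀ i, O.valuation (p.coeff i / p.coeff j) ≤ 1 := by
    intro i
    rw [map_div₀]
    refine div_le_one_of_le₀ ?_ zero_le
    by_cases hi : i ∈ p.support
    · exact hmax i hi
    · rw [notMem_support_iff.1 hi, map_zero]
      exact zero_le
  have hmem : ∀ i, p.coeff i / p.coeff j ∈ O := fun i => (O.valuation_le_one_iff _).1 (hle i)
  have h := mem_or_inv_mem_of_aeval_eq_zero (D := D) (F := F)
    (fun z hz => (hrange z).2 (isIntegral_trans z hz)) p.natDegree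
    (fun i => algebraMap O D ⟨_, hmem i⟩) z hz ?_ ⟨j, le_natDegree_of_mem_supp j hj, ?_⟩
  · simpa only [hrange] using h
  · rw [aeval_eq_sum_range] at hp
    have : ∀ i, algebraMap D F (algebraMap O D ⟨_, hmem i⟩) =
        algebraMap k F (p.coeff j)⁻¹ * algebraMap k F (p.coeff i) := by
      intro i
      rw [← map_mul, inv_mul_eq_div]
      rfl
    simp only [this, mul_assoc, ← Finset.mul_sum]
    simp only [Algebra.smul_def] at hp
    rw [hp, mul_zero]
  · have : (⟨_, hmem j⟩ : O) = 1 := Subtype.ext (div_self hj0)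
    rw [this, map_one]
    exact isUnit_one

theorem isIntegral_or_isIntegral_inv_of_henselian {k F : Type*} [Field k] [Field F] [Algebra k F]
    [IsGalois k F] (O : ValuationSubring k) [HenselianLocalRing O] (z : F) :
    IsIntegral O z ∨ IsIntegral O z⁻¹ := by
  let N : IntermediateField k F :=
    IntermediateField.normalClosure k (IntermediateField.adjoin k {z}) F
  have : FiniteDimensional k (IntermediateField.adjoin k {z}) :=
    IntermediateField.adjoin.finiteDimensional (Algebra.IsIntegral.isIntegral z)
  have : IsGalois k N := ⟨⟩
  have hz : z ∈ N :=
    IntermediateField.le_normalClosure _ (IntermediateField.mem_adjoin_simple_self k z)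
  have := isIntegral_or_isIntegral_inv_of_finiteDimensional O (⟨z, hz⟩ : N)
  exact this.imp (fun h => h.map (N.val.restrictScalars O)) fun h => h.map (N.val.restrictScalars O)

/-- The integral closure of a Henselian valuation ring in a Galois extension, as a valuation
subring. -/
def henselianExtension {k F : Type*} [Field k] [Field F] [Algebra k F]
    [IsGalois k F] (O : ValuationSubring k) [HenselianLocalRing O] : ValuationSubring F where
  __ := (integralClosure O F).toSubring
  mem_or_inv_mem' z := isIntegral_or_isIntegral_inv_of_henselian O z


end Henselian

/-! ### Smoothness descends along finite étale extensions -/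

/-- An étale algebra `R` over `S` lifts along a surjection `A → S` with square-zero kernel `J`:
there is a flat `A`-algebra `T` of finite presentation with `T / J T = R`. It is obtained by lifting
the equations of a standard smooth presentation of `R`. -/
theorem exists_flat_lift_of_etale.{u, v, w} {A : Type u} {S : Type v} {R : Type w}
    [CommRing A] [CommRing S] [CommRing R]
    [Algebra A S] [Algebra S R] [Algebra A R] [IsScalarTower A S R] [Algebra.Etale S R]
    (hsurj : Function.Surjective (algebraMap A S))
    (hsq : RingHom.ker (algebraMap A S) ^ 2 = ⊥) :
    ∃ (T : Type u) (_ : CommRing T) (_ : Algebra A T) (θ : T →ₐ[A] R), Function.Surjective θ ∧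
      RingHom.ker θ = (RingHom.ker (algebraMap A S)).map (algebraMap A T) ∧
      Module.Flat A T ∧ Algebra.FinitePresentation A T := by
  classical
  obtain ⟨ι, σ, _, _, ⟨P⟩⟩ : Algebra.IsStandardSmooth S R :=
    (Algebra.Etale.iff_isStandardSmoothOfRelativeDimension_zero.1 ‹_›).isStandardSmooth
  cases nonempty_fintype σ
  set J := RingHom.ker (algebraMap A S) with hJ
  have hmsurj : Function.Surjective (MvPolynomial.map (σ := ι) (algebraMap A S)) :=
    MvPolynomial.map_surjective _ hsurj
  choose g hg using fun i => hmsurj (P.relation i)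
  let I := Ideal.span (Set.range g)
  let T := MvPolynomial ι A ⧸ I
  have haeval : ∀ q : MvPolynomial ι A, MvPolynomial.aeval P.val q =
      MvPolynomial.aeval P.val (MvPolynomial.map (algebraMap A S) q) := fun q => by
    rw [MvPolynomial.aeval_map_algebraMap]
  have hker : ∀ q : MvPolynomial ι A, MvPolynomial.aeval (R := A) P.val q = 0 ↔
      q ∈ I ⊔ J.map MvPolynomial.C := by
    intro q
    have h1 : I.map (MvPolynomial.map (algebraMap A S)) = P.ker := by
      rw [Ideal.map_span, ← Set.range_comp, ← P.span_range_relation_eq_ker]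
      congr 2
      exact funext hg
    have h2 : I ⊔ J.map MvPolynomial.C = Ideal.comap (MvPolynomial.map (algebraMap A S)) P.ker := by
      rw [← h1, Ideal.comap_map_of_surjective _ hmsurj, ← RingHom.ker_eq_comap_bot,
        MvPolynomial.ker_map]
    rw [h2, Ideal.mem_comap, haeval, P.ker_eq_ker_aeval_val]
    rfl
  let θ : T →ₐ[A] R := Ideal.Quotient.liftₐ I (MvPolynomial.aeval P.val) fun q hq =>
    (hker q).2 (Ideal.mem_sup_left hq)
  have hθ : ∀ q, θ (Ideal.Quotient.mk I q) = MvPolynomial.aeval P.val q := fun q => rfl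
  have hθsurj : Function.Surjective θ := by
    intro r
    obtain ⟨q, hq⟩ := hmsurj (P.σ r)
    refine ⟨Ideal.Quotient.mk I q, ?_⟩
    rw [hθ, haeval, hq]
    exact P.aeval_val_σ r
  have hθker : RingHom.ker θ = J.map (algebraMap A T) := by
    ext x
    obtain ⟨q, rfl⟩ := Ideal.Quotient.mk_surjective x
    rw [RingHom.mem_ker, hθ, hker]
    have : algebraMap A T = (Ideal.Quotient.mk I).comp MvPolynomial.C := rfl
    rw [this, ← Ideal.map_map, Ideal.mem_map_iff_of_surjective _ Ideal.Quotient.mk_surjective]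
    constructor
    · intro h
      obtain ⟨y, hy, z, hz, rfl⟩ := Submodule.mem_sup.1 h
      exact ⟨z, hz, by rw [map_add, Ideal.Quotient.eq_zero_iff_mem.2 hy, zero_add]⟩
    · rintro ⟨z, hz, hzq⟩
      rw [Ideal.Quotient.eq] at hzq
      have := Ideal.sub_mem _ (Ideal.mem_sup_right (S := I) hz)
        (Ideal.mem_sup_left (T := J.map MvPolynomial.C) hzq)
      rwa [sub_sub_cancel] at this
  have hunit : ∀ x : T, IsUnit (θ x) → IsUnit x := by
    intro x hx
    obtain ⟨v, hv⟩ := hx.exists_right_inv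
    obtain ⟨v, rfl⟩ := hθsurj v
    have h1 : x * v - 1 ∈ RingHom.ker θ := by
      rw [RingHom.mem_ker, map_sub, map_mul, hv, map_one, sub_self]
    have h2 : (x * v - 1) ^ 2 = 0 := by
      have := Ideal.pow_mem_pow h1 2
      rwa [hθker, ← Ideal.map_pow, hsq, Ideal.map_bot] at this
    have h3 : IsUnit (x * v) := by
      have := (show IsNilpotent (x * v - 1) from ⟨2, h2⟩).isUnit_add_one
      rwa [sub_add_cancel] at this
    exact isUnit_of_mul_isUnit_left h3
  let Q := Algebra.PreSubmersivePresentation.naive (R := A) (v := g) P.map P.map_inj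
  have hQ : IsUnit Q.jacobian := by
    apply hunit
    have h1 : θ Q.jacobian = P.jacobian := by
      rw [Q.jacobian_eq_jacobiMatrix_det, P.jacobian_eq_jacobiMatrix_det]
      have h2 : P.jacobiMatrix = Q.jacobiMatrix.map (MvPolynomial.map (algebraMap A S)) := by
        ext i j : 1
        rw [P.jacobiMatrix_apply, Matrix.map_apply]
        change _ = MvPolynomial.map (algebraMap A S) (Q.jacobiMatrix i j)
        rw [Algebra.PreSubmersivePresentation.jacobiMatrix_naive, ← MvPolynomial.pderiv_map, hg]
      have h3 : P.jacobiMatrix.det = MvPolynomial.map (algebraMap A S) Q.jacobiMatrix.det := by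
        rw [h2, RingHom.map_det, RingHom.mapMatrix_apply]
      rw [h3, P.algebraMap_apply, ← haeval]
      rfl
    rw [h1]
    exact P.jacobian_isUnit
  have hS : Algebra.IsStandardSmooth A T :=
    (⟨Q, hQ⟩ : Algebra.SubmersivePresentation A T ι σ).isStandardSmooth
  refine ⟨T, inferInstance, inferInstance, θ, hθsurj, hθker, ?_, ?_⟩
  · have : Algebra.Smooth A T := inferInstance
    exact Algebra.Smooth.flat A T
  · infer_instance

/-- Nakayama's lemma for an ideal of square zero. -/
theorem Module.Finite.of_quotient_of_sq_eq_bot {A T R : Type*} [CommRing A] [CommRing T]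
    [CommRing R] [Algebra A T] [Algebra A R] [Module.Finite A R] (θ : T →ₐ[A] R)
    (hθ : Function.Surjective θ) (J : Ideal A) (hJ : J ^ 2 = ⊥)
    (hker : RingHom.ker θ = J.map (algebraMap A T)) : Module.Finite A T := by
  obtain ⟨s, hs⟩ := Module.Finite.fg_top (R := A) (M := R)
  classical
  choose l hl using hθ
  let N : Submodule A T := Submodule.span A (l '' (s : Set R))
  have hN : N.map θ.toLinearMap = ⊤ := by
    rw [Submodule.map_span, ← Set.image_comp, ← hs]
    congr 1
    convert Set.image_id _
    exact funext hl
  have h1 : ∀ t : T, ∃ n ∈ N, t - n ∈ J • (⊤ : Submodule A T) := by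
    intro t
    have : θ t ∈ N.map θ.toLinearMap := hN ▸ Submodule.mem_top
    obtain ⟨n, hn, hnt⟩ := this
    refine ⟨n, hn, ?_⟩
    have : t - n ∈ RingHom.ker θ := by
      rw [RingHom.mem_ker, map_sub, ← hnt]
      exact sub_self _
    rw [hker] at this
    rw [Ideal.smul_top_eq_map]
    exact this
  have h2 : J • (⊤ : Submodule A T) ≤ N := by
    refine Submodule.smul_le.2 fun j hj t _ => ?_
    obtain ⟨n, hn, h⟩ := h1 t
    have h3 : j • (t - n) ∈ J ^ 2 • (⊤ : Submodule A T) := by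
      rw [pow_two, mul_smul]
      exact Submodule.smul_mem_smul hj h
    rw [hJ, Submodule.bot_smul, Submodule.mem_bot, smul_sub, sub_eq_zero] at h3
    rw [h3]
    exact N.smul_mem _ hn
  have h3 : N = ⊤ := by
    rw [eq_top_iff]
    intro t _
    obtain ⟨n, hn, h⟩ := h1 t
    have := N.add_mem (h2 h) hn
    rwa [sub_add_cancel] at this
  refine ⟨h3 ▸ Submodule.fg_span (s.finite_toSet.image l)⟩

/-- Let `S → R` be finite étale with an `S`-linear retraction, and let `R` be formally smooth
over `K`. Then every square-zero extension `A` of `S` over `K` splits: the extension lifts to one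
of `R`, which splits, and the resulting derivation is transported back to `A`. -/
theorem exists_section_of_etale {K A S R : Type*} [CommRing K] [CommRing A] [CommRing S]
    [CommRing R] [Algebra K A] [Algebra K S] [Algebra K R] [Algebra A S] [Algebra S R]
    [IsScalarTower K A S] [IsScalarTower K S R] [Algebra.Etale S R] [Module.Finite S R]
    [Algebra.FormallySmooth K R] (lam : R →ₗ[S] S) (hlam : lam 1 = 1)
    (hsurj : Function.Surjective (algebraMap A S))
    (hsq : RingHom.ker (algebraMap A S) ^ 2 = ⊥) :
    ∃ g : S →ₐ[K] A, ∀ s, algebraMap A S (g s) = s := by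
  let _ : Algebra A R := ((algebraMap S R).comp (algebraMap A S)).toAlgebra
  have : IsScalarTower A S R := .of_algebraMap_eq' rfl
  have : IsScalarTower K A R := .of_algebraMap_eq fun k => by
    rw [IsScalarTower.algebraMap_apply A S R, ← IsScalarTower.algebraMap_apply K A S,
      ← IsScalarTower.algebraMap_apply K S R]
  obtain ⟨T, _, _, θ, hθ, hker, _, _⟩ := exists_flat_lift_of_etale (R := R) hsurj hsq
  set J := RingHom.ker (algebraMap A S) with hJ
  have : Module.Finite A S := Module.Finite.of_surjective (Algebra.linearMap A S) hsurj
  have : Module.Finite A R := Module.Finite.trans S R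
  have : Module.Finite A T := .of_quotient_of_sq_eq_bot θ hθ J hsq hker
  have : Module.FinitePresentation A T := .of_finite_of_finitePresentation A T
  have : Module.Projective A T := Module.Flat.projective_of_finitePresentation
  obtain ⟨r, hr⟩ := Module.projective_lifting_property (Algebra.linearMap A S)
    (lam.restrictScalars A ∘ₗ θ.toLinearMap) hsurj
  have hr' : ∀ t, algebraMap A S (r t) = lam (θ t) := fun t => LinearMap.congr_fun hr t
  have hJ2 : ∀ a ∈ J, ∀ b ∈ J, a * b = 0 := fun a ha b hb => by
    have := Ideal.mul_mem_mul ha hb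
    rwa [← pow_two, hsq] at this
  have hkerpow : RingHom.ker θ ^ 2 = ⊥ := by rw [hker, ← Ideal.map_pow, hsq, Ideal.map_bot]
  have hM2 : ∀ a ∈ RingHom.ker θ, ∀ b ∈ RingHom.ker θ, a * b = 0 := fun a ha b hb => by
    have := Ideal.mul_mem_mul ha hb
    rwa [← pow_two, hkerpow] at this
  let _ : Algebra K T := ((algebraMap A T).comp (algebraMap K A)).toAlgebra
  have : IsScalarTower K A T := .of_algebraMap_eq' rfl
  let θK : T →ₐ[K] R := θ.restrictScalars K
  let h : R →ₐ[K] T := Algebra.FormallySmooth.liftOfSurjective (AlgHom.id K R) θK hθ ⟨2, hkerpow⟩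
  have hh : ∀ x, θ (h x) = x := fun x =>
    Algebra.FormallySmooth.liftOfSurjective_apply (AlgHom.id K R) θK hθ ⟨2, hkerpow⟩ x
  -- The difference of the two maps from `A` to `T`; its composition with the `A`-linear map
  -- `r : T → A` that lifts `lam` is a derivation from `A` to `J` that is the identity on `J`.
  let D : A → T := fun a => algebraMap A T a - h (algebraMap A R a)
  have hD : ∀ a, D a ∈ RingHom.ker θ := fun a => by
    rw [RingHom.mem_ker, map_sub, hh, AlgHom.commutes, sub_self]
  have hδJ : ∀ t ∈ RingHom.ker θ, r t ∈ J := fun t ht => by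
    rw [hJ, RingHom.mem_ker, hr', (RingHom.mem_ker).1 ht, map_zero]
  have hDmul : ∀ a b, D (a * b) = a • D b + b • D a := fun a b => by
    have := hM2 _ (hD a) _ (hD b)
    simp only [D, Algebra.smul_def, map_mul] at this ⊢
    linear_combination (-1 : T) * this
  have hDadd : ∀ a b, D (a + b) = D a + D b := fun a b => by
    simp only [D, map_add]
    ring
  have hDK : ∀ k : K, D (algebraMap K A k) = 0 := fun k => by
    simp only [D]
    rw [← IsScalarTower.algebraMap_apply, ← IsScalarTower.algebraMap_apply, AlgHom.commutes,
      sub_self]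
  let τ : A →ₐ[K] A :=
    { toFun := fun a => a - r (D a)
      map_one' := by
        have := hDK 1
        rw [map_one] at this
        simp [this]
      map_mul' := fun a b => by
        have := hJ2 _ (hδJ _ (hD a)) _ (hδJ _ (hD b))
        rw [hDmul, map_add, map_smul, map_smul, smul_eq_mul, smul_eq_mul]
        linear_combination (-1 : A) * this
      map_zero' := by
        have := hDK 0
        rw [map_zero] at this
        simp [this]
      map_add' := fun a b => by
        rw [hDadd, map_add]
        ring
      commutes' := fun k => by rw [hDK, map_zero, sub_zero] }
  have hτJ : ∀ a ∈ J, τ a = 0 := by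
    intro a ha
    have h1 : D a = a • (1 : T) := by
      simp only [D]
      rw [IsScalarTower.algebraMap_apply A S R, (RingHom.mem_ker).1 ha, map_zero, map_zero,
        sub_zero, Algebra.algebraMap_eq_smul_one]
    have h2 : r 1 - 1 ∈ J := by
      rw [hJ, RingHom.mem_ker, map_sub, hr', map_one θ, hlam, map_one, sub_self]
    have h3 := hJ2 _ ha _ h2
    change a - r (D a) = 0
    rw [h1, map_smul, smul_eq_mul]
    linear_combination (-1 : A) * h3
  have hπτ : ∀ a, algebraMap A S (τ a) = algebraMap A S a := fun a => by
    change algebraMap A S (a - r (D a)) = _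
    rw [map_sub, (RingHom.mem_ker).1 (hδJ _ (hD a)), sub_zero]
  let π : A →ₐ[K] S := IsScalarTower.toAlgHom K A S
  let e := Ideal.quotientKerAlgEquivOfSurjective (f := π) hsurj
  let τ' : (A ⧸ RingHom.ker π) →ₐ[K] A := Ideal.Quotient.liftₐ _ τ hτJ
  refine ⟨τ'.comp e.symm, fun s => ?_⟩
  obtain ⟨a, rfl⟩ := hsurj s
  have : e.symm (algebraMap A S a) = Ideal.Quotient.mk _ a := by
    rw [AlgEquiv.symm_apply_eq]
    rfl
  change algebraMap A S (τ' (e.symm _)) = _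
  rw [this]
  exact hπτ a

/-- Formal smoothness descends along finite étale extensions that have a linear retraction. -/
theorem Algebra.FormallySmooth.of_etale_of_retraction {K S R : Type*} [CommRing K] [CommRing S]
    [CommRing R] [Algebra K S] [Algebra K R] [Algebra S R] [IsScalarTower K S R]
    [Algebra.Etale S R] [Module.Finite S R] [Algebra.FormallySmooth K R]
    (lam : R →ₗ[S] S) (hlam : lam 1 = 1) : Algebra.FormallySmooth K S := by
  let f : MvPolynomial S K →ₐ[K] S := MvPolynomial.aeval _root_.id
  have hf : Function.Surjective f := fun s => ⟨MvPolynomial.X s, by simp [f]⟩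
  let A := MvPolynomial S K ⧸ RingHom.ker f.toRingHom ^ 2
  let _ : Algebra A S := f.kerSquareLift.toRingHom.toAlgebra
  have : IsScalarTower K A S := .of_algebraMap_eq' f.kerSquareLift.comp_algebraMap.symm
  have hsurj : Function.Surjective (algebraMap A S) := fun s => by
    obtain ⟨p, hp⟩ := hf s
    exact ⟨Ideal.Quotient.mk _ p, hp⟩
  have hsq : RingHom.ker (algebraMap A S) ^ 2 = ⊥ := by
    have : RingHom.ker (algebraMap A S) = (RingHom.ker f.toRingHom).cotangentIdeal :=
      AlgHom.ker_kerSquareLift f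
    rw [this, Ideal.cotangentIdeal_square]
  obtain ⟨g, hg⟩ := exists_section_of_etale (K := K) lam hlam hsurj hsq
  exact .of_split f g (AlgHom.ext hg)

/-! ### Rings of invariants with a normal basis -/

/-- Two functions `t, u : B → R` on a finite group are dual if `∑ e, u e * t (b * e)` is `1` for
`b = 1` and `0` otherwise.  For `t b = b • y` this says that `y` generates a normal basis, and `u`
is the orbit of the generator of the dual basis. -/
def IsDualFamily {B R : Type*} [Group B] [Fintype B] [DecidableEq B] [CommRing R] (t u : B → R) :
    Prop :=
  ∀ b, ∑ e, u e * t (b * e) = if b = 1 then 1 else 0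

namespace IsDualFamily

variable {B R : Type*} [Group B] [Fintype B] [DecidableEq B] [CommRing R] {t u u' : B → R}

theorem sum_left (h : IsDualFamily t u) (b g : B) :
    ∑ e, u (g * e) * t (b * e) = if b = g then 1 else 0 := by
  rw [← Equiv.sum_comp (Equiv.mulLeft g⁻¹)]
  have := h (b * g⁻¹)
  simpa [mul_assoc, mul_inv_eq_one] using this

theorem mul_eq_one (h : IsDualFamily t u) :
    (Matrix.of fun b e => t (b * e)) * (Matrix.of fun e g => u (g * e)) = 1 := by
  ext b g
  rw [Matrix.mul_apply, Matrix.one_apply, ← h.sum_left b g]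
  exact Finset.sum_congr rfl fun e _ => mul_comm _ _

theorem sum_right (h : IsDualFamily t u) (e e' : B) :
    ∑ b, u (b * e) * t (b * e') = if e = e' then 1 else 0 := by
  have h1 : (Matrix.of fun e g => u (g * e)) * (Matrix.of fun b e => t (b * e)) = 1 :=
    mul_eq_one_comm.1 h.mul_eq_one
  have := congr_fun₂ h1 e e'
  rwa [Matrix.mul_apply, Matrix.one_apply] at this

theorem unique (h : IsDualFamily t u) (h' : IsDualFamily t u') : u = u' := by
  have h1 : (Matrix.of fun e g => u (g * e)) * (Matrix.of fun b e => t (b * e)) = 1 :=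
    mul_eq_one_comm.1 h.mul_eq_one
  have h2 := left_inv_eq_right_inv h1 h'.mul_eq_one
  ext e
  simpa using congr_fun₂ h2 e 1

theorem translate (h : IsDualFamily t u) (g : B) :
    IsDualFamily (fun b => t (g * b)) (fun b => u (g * b)) := by
  intro b
  have := h.sum_left (g * b) g
  simpa [mul_assoc] using this

theorem map {R' F : Type*} [CommRing R'] [FunLike F R R'] [RingHomClass F R R'] (σ : F)
    (h : IsDualFamily t u) : IsDualFamily (fun b => σ (t b)) (fun b => σ (u b)) := by
  intro b
  have := congrArg σ (h b)
  simpa [map_sum, apply_ite σ] using this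

/-- A ring endomorphism that translates `t` also translates the dual family. -/
theorem map_eq_translate {F : Type*} [FunLike F R R] [RingHomClass F R R] (σ : F)
    (h : IsDualFamily t u) (g : B) (hσ : ∀ b, σ (t b) = t (g * b)) (b : B) :
    σ (u b) = u (g * b) := by
  have h1 := h.map σ
  simp only [hσ] at h1
  exact congr_fun (h1.unique (h.translate g)) b

theorem isUnit_det (h : IsDualFamily t u) :
    IsUnit (Matrix.of fun b e => t (b * e)).det := by
  have := congrArg Matrix.det h.mul_eq_one
  rw [Matrix.det_mul, Matrix.det_one] at this
  exact IsUnit.of_mul_eq_one _ this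

theorem exists_of_isUnit_det (h : IsUnit (Matrix.of fun b e => t (b * e)).det) :
    ∃ u, IsDualFamily t u := by
  refine ⟨fun e => (Matrix.of fun b e => t (b * e))⁻¹ e 1, fun b => ?_⟩
  have := congr_fun₂ (Matrix.mul_nonsing_inv _ h) b 1
  rw [Matrix.mul_apply, Matrix.one_apply] at this
  rw [← this]
  exact Finset.sum_congr rfl fun e _ => mul_comm _ _

end IsDualFamily

namespace NormalBasisAlgebra

variable {K R B : Type*} [CommRing K] [CommRing R] [Algebra K R] [Group B] [Fintype B]
  [DecidableEq B] [MulSemiringAction B R] [SMulCommClass B K R]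

/-- The trace from `R` to its ring of invariants, as a linear map over that ring. -/
def trace (K R B : Type*) [CommRing K] [CommRing R] [Algebra K R] [Group B] [Fintype B]
    [MulSemiringAction B R] [SMulCommClass B K R] :
    R →ₗ[FixedPoints.subalgebra K R B] FixedPoints.subalgebra K R B where
  toFun r := ⟨∑ b : B, b • r, fun g => by
    rw [Finset.smul_sum]
    simp only [smul_smul]
    exact Equiv.sum_comp (Equiv.mulLeft g) fun b => b • r⟩
  map_add' x y := Subtype.ext (by simp [Finset.sum_add_distrib])
  map_smul' s x := Subtype.ext (by
    simp only [smul_eq_mul, RingHom.id_apply, Algebra.smul_def, smul_mul', MulMemClass.coe_mul,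
      Finset.mul_sum]
    refine Finset.sum_congr rfl fun b _ => ?_
    congr 1
    exact s.2 b)

omit [DecidableEq B] in
theorem coe_trace (r : R) : (trace K R B r : R) = ∑ b : B, b • r := rfl

variable {y : R} {u : B → R} (h : IsDualFamily (fun b : B => b • y) u)

include h in
theorem smul_dual (b e : B) : b • u e = u (b * e) :=
  h.map_eq_translate (MulSemiringAction.toRingHom B R b) b (fun c => smul_smul b c y) e

include h in
/-- The expansion of an element of `R` in the normal basis. -/
theorem sum_trace_smul (r : R) :
    ∑ e, trace K R B (u e * r) • (e • y) = r := by
  simp only [Algebra.smul_def]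
  change ∑ e, (∑ b : B, b • (u e * r)) * (e • y) = r
  simp only [smul_mul', smul_dual h, Finset.sum_mul]
  rw [Finset.sum_comm]
  have h1 : ∀ b : B, ∑ e, u (b * e) * b • r * e • y = b • r * if 1 = b then 1 else 0 := by
    intro b
    rw [← h.sum_left 1 b, Finset.mul_sum]
    refine Finset.sum_congr rfl fun e _ => ?_
    rw [one_mul]
    ring
  simp [h1]

include h in
theorem linearIndependent :
    LinearIndependent (FixedPoints.subalgebra K R B) fun b : B => b • y := by
  rw [Fintype.linearIndependent_iff]
  intro g hg e
  have h1 : ∀ b : B, ∑ e, (g e : R) * (b * e) • y = 0 := by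
    intro b
    have := congrArg (b • ·) hg
    simp only [Finset.smul_sum, smul_zero] at this
    rw [← this]
    refine Finset.sum_congr rfl fun e _ => ?_
    rw [Algebra.smul_def, smul_mul', mul_smul]
    congr 1
    exact ((g e).2 b).symm
  have h2 : ∑ b : B, u (b * e) * ∑ e', (g e' : R) * (b * e') • y = g e := by
    simp only [Finset.mul_sum]
    rw [Finset.sum_comm]
    have h3 : ∀ e', ∑ b, u (b * e) * ((g e' : R) * (b * e') • y) =
        g e' * if e = e' then 1 else 0 := by
      intro e'
      rw [← h.sum_right e e', Finset.mul_sum]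
      exact Finset.sum_congr rfl fun b _ => by ring
    simp [h3]
  simp only [h1, mul_zero, Finset.sum_const_zero] at h2
  exact Subtype.ext h2.symm

/-- The orbit of `y` is a basis of `R` over the ring of invariants. -/
noncomputable def basis : Module.Basis B (FixedPoints.subalgebra K R B) R :=
  Module.Basis.mk (v := fun b : B => b • y) (linearIndependent h) fun r _ => by
    rw [← sum_trace_smul (K := K) h r]
    exact Submodule.sum_mem _ fun e _ =>
      Submodule.smul_mem _ _ (Submodule.subset_span (Set.mem_range_self e))

include h

theorem finite : Module.Finite (FixedPoints.subalgebra K R B) R := .of_basis (basis h)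

theorem free : Module.Free (FixedPoints.subalgebra K R B) R := .of_basis (basis h)

/-- `R` is étale over its ring of invariants: `∑ e, u e ⊗ (e • y)` is a separability idempotent. -/
theorem etale : Algebra.Etale (FixedPoints.subalgebra K R B) R := by
  set S := FixedPoints.subalgebra K R B
  have := finite (K := K) h
  have := free (K := K) h
  have : Module.FinitePresentation S R := Module.finitePresentation_of_projective S R
  have : Algebra.FormallyUnramified S R := by
    rw [Algebra.FormallyUnramified.iff_exists_tensorProduct]
    refine ⟨∑ e, u e ⊗ₜ[S] (e • y), fun r => ?_, ?_⟩
    · rw [sub_mul, sub_eq_zero, Finset.mul_sum, Finset.mul_sum]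
      simp only [Algebra.TensorProduct.tmul_mul_tmul, one_mul]
      have h1 : ∀ e : B, r * e • y = ∑ d, trace K R B (u d * (r * e • y)) • (d • y) :=
        fun e => (sum_trace_smul h _).symm
      conv_lhs =>
        enter [2, e]
        rw [h1 e, TensorProduct.tmul_sum]
      rw [Finset.sum_comm]
      refine Finset.sum_congr rfl fun d _ => ?_
      simp only [TensorProduct.tmul_smul]
      simp only [TensorProduct.smul_tmul', ← TensorProduct.sum_tmul]
      congr 1
      simp only [Algebra.smul_def]
      change ∑ e, (∑ b : B, b • (u d * (r * e • y))) * u e = _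
      simp only [smul_mul', Finset.sum_mul]
      rw [Finset.sum_comm]
      have h2 : ∀ b : B, ∑ e, b • u d * (b • r * b • e • y) * u e =
          b • u d * b • r * if b = 1 then 1 else 0 := by
        intro b
        rw [← h b, Finset.mul_sum]
        refine Finset.sum_congr rfl fun e _ => ?_
        rw [smul_smul]
        ring
      rw [Finset.sum_congr rfl fun b _ => h2 b]
      simp [mul_comm]
    · rw [map_sum]
      simpa using h 1
  exact Algebra.Etale.of_formallyUnramified_of_flat

/-- The ring of invariants is a direct summand of `R`: the trace is surjective, since the elements
`trace (u e)` are independent of `e` and their common value times `∑ e, e • y` is `1`. -/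
theorem exists_retraction :
    ∃ lam : R →ₗ[FixedPoints.subalgebra K R B] FixedPoints.subalgebra K R B, lam 1 = 1 := by
  set S := FixedPoints.subalgebra K R B
  refine ⟨trace K R B ∘ₗ LinearMap.mulLeft S ((∑ b, u b) * y), Subtype.ext ?_⟩
  change ∑ b : B, b • ((∑ b, u b) * y * 1) = 1
  have h1 : ∀ e : B, (trace K R B (u e * 1) : R) = ∑ b, u b := by
    intro e
    rw [coe_trace]
    simp only [mul_one, smul_dual h]
    exact Equiv.sum_comp (Equiv.mulRight e) u
  have h2 := sum_trace_smul (K := K) h 1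
  simp only [Algebra.smul_def] at h2
  conv_rhs => rw [← h2]
  refine Finset.sum_congr rfl fun e _ => ?_
  rw [mul_one, smul_mul', Finset.smul_sum]
  congr 1
  change _ = (trace K R B (u e * 1) : R)
  rw [h1]
  simp only [smul_dual h]
  exact Equiv.sum_comp (Equiv.mulLeft e) u

theorem formallySmooth [Algebra.FormallySmooth K R] :
    Algebra.FormallySmooth K (FixedPoints.subalgebra K R B) := by
  have := finite (K := K) h
  have := etale (K := K) h
  obtain ⟨lam, hlam⟩ := exists_retraction (K := K) h
  exact .of_etale_of_retraction lam hlam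

theorem finiteType [IsNoetherianRing K] [Algebra.FiniteType K R] :
    Algebra.FiniteType K (FixedPoints.subalgebra K R B) := by
  have := finite (K := K) h
  exact ⟨fg_of_fg_of_fg K _ R Algebra.FiniteType.out Module.Finite.fg_top Subtype.val_injective⟩

theorem smooth [IsNoetherianRing K] [Algebra.Smooth K R] :
    Algebra.Smooth K (FixedPoints.subalgebra K R B) := by
  have := finiteType (K := K) h
  exact ⟨formallySmooth h, Algebra.FinitePresentation.of_finiteType.1 this⟩

end NormalBasisAlgebra

/-! ### Normal bases, Galois descent and points -/

/-- Dual bases of a finite Galois extension with respect to the trace detect the identity. -/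
theorem sum_traceDual_mul_apply {K L ι : Type*} [Field K] [Field L] [Algebra K L]
    [FiniteDimensional K L] [IsGalois K L] [Fintype ι] [DecidableEq ι] (m : Module.Basis ι K L)
    [DecidableEq Gal(L/K)] (τ : Gal(L/K)) :
    ∑ k, m.traceDual k * τ (m k) = if τ = 1 then 1 else 0 := by
  have h1 : ∀ x : L, ∑ σ : Gal(L/K), (∑ k, m.traceDual k * σ (m k)) * σ x = x := by
    intro x
    conv_rhs => rw [← m.traceDual.sum_repr x]
    simp only [Module.Basis.traceDual_repr_apply, Algebra.traceForm_apply, Algebra.smul_def,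
      trace_eq_sum_automorphisms, map_mul, Finset.sum_mul]
    rw [Finset.sum_comm]
    refine Finset.sum_congr rfl fun k _ => Finset.sum_congr rfl fun σ _ => by ring
  have h2 := (linearIndependent_monoidHom L L).comp
    (fun σ : Gal(L/K) => ((σ : L →+* L) : L →* L)) (fun σ σ' h => by
      ext x
      exact DFunLike.congr_fun h x)
  rw [Fintype.linearIndependent_iff] at h2
  have h3 := h2 (fun σ => (∑ k, m.traceDual k * σ (m k)) - if σ = 1 then 1 else 0) (by
    ext x
    have := h1 x
    simp only [Finset.sum_apply, Pi.smul_apply, smul_eq_mul, sub_mul, Finset.sum_sub_distrib,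
      Function.comp, Pi.zero_apply]
    rw [sub_eq_zero]
    refine this.trans ?_
    simp) τ
  exact sub_eq_zero.1 h3

/-- Let `γ` be a homomorphism from the Galois group of `Ω / F` to a finite group `B` with open
kernel. Then the induced module of functions `B → Ω` has a normal basis: there is a family `t`
on which `Gal(Ω / F)` acts through `γ` and which has a dual family. -/
theorem exists_isDualFamily_of_galois {F Ω B : Type*} [Field F] [Field Ω] [Algebra F Ω]
    [IsGalois F Ω] [Group B] [Fintype B] [DecidableEq B] (γ : Gal(Ω/F) →* B)
    (hγ : IsOpen (γ.ker : Set Gal(Ω/F))) :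
    ∃ t u : B → Ω, IsDualFamily t u ∧ ∀ σ b, σ (t b) = t (γ σ * b) := by
  classical
  let M : IntermediateField F Ω := IntermediateField.fixedField γ.ker
  have hM : M.fixingSubgroup = γ.ker :=
    InfiniteGalois.fixingSubgroup_fixedField ⟨γ.ker, Subgroup.isClosed_of_isOpen _ hγ⟩
  have hfin : FiniteDimensional F M := by
    rw [← InfiniteGalois.isOpen_iff_finite, hM]
    exact hγ
  have hgal : IsGalois F M := by
    rw [← InfiniteGalois.normal_iff_isGalois, hM]
    infer_instance
  have hker : (AlgEquiv.restrictNormalHom (F := F) (K₁ := Ω) M).ker = γ.ker := by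
    rw [IntermediateField.restrictNormalHom_ker, hM]
  let r := AlgEquiv.restrictNormalHom (F := F) (K₁ := Ω) M
  have hr : Function.Surjective r := AlgEquiv.restrictNormalHom_surjective Ω
  obtain ⟨κ, hκ⟩ : ∃ κ : Gal(M/F) →* B, ∀ σ, κ (r σ) = γ σ :=
    ⟨r.liftOfSurjective hr ⟨γ, hker.le⟩,
      fun σ => r.liftOfRightInverse_comp_apply _ _ ⟨γ, hker.le⟩ σ⟩
  have hκinj : Function.Injective κ := by
    rw [injective_iff_map_eq_one]
    intro ρ hρ
    obtain ⟨σ, rfl⟩ := hr ρ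
    rw [hκ] at hρ
    have : σ ∈ r.ker := by
      rw [hker]
      exact hρ
    exact this
  -- A normal basis of `M` over `F` and its dual basis, extended by zero to `B`.
  obtain ⟨m, hm⟩ : ∃ m : Module.Basis Gal(M/F) F M, ∀ ρ, m ρ = ρ (m 1) :=
    ⟨IsGalois.normalBasis F M, fun ρ => IsGalois.normalBasis_apply ρ⟩
  let t : B → Ω := Function.extend κ (fun ρ => (m ρ : Ω)) 0
  let u : B → Ω := Function.extend κ (fun ρ => (m.traceDual ρ : Ω)) 0
  have ht : ∀ ρ, t (κ ρ) = m ρ := fun ρ => hκinj.extend_apply _ _ _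
  have hu : ∀ ρ, u (κ ρ) = m.traceDual ρ := fun ρ => hκinj.extend_apply _ _ _
  have ht0 : ∀ b, b ∉ Set.range κ → t b = 0 := fun b hb => Function.extend_apply' _ _ _ hb
  have hu0 : ∀ b, b ∉ Set.range κ → u b = 0 := fun b hb => Function.extend_apply' _ _ _ hb
  refine ⟨t, u, fun b => ?_, fun σ b => ?_⟩
  · have h1 : ∑ e, u e * t (b * e) = ∑ ρ, u (κ ρ) * t (b * κ ρ) := by
      symm
      refine Finset.sum_of_injOn κ hκinj.injOn (by simp) (fun e _ he => ?_) (fun _ _ => rfl)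
      rw [hu0 e (by simpa using he), zero_mul]
    rw [h1]
    by_cases hb : b ∈ Set.range κ
    · obtain ⟨τ, rfl⟩ := hb
      have h2 := congrArg (algebraMap M Ω) (sum_traceDual_mul_apply m τ)
      rw [map_sum] at h2
      have h3 : (κ τ = 1) ↔ τ = 1 := map_eq_one_iff _ hκinj
      simp only [h3]
      refine Eq.trans (Finset.sum_congr rfl fun ρ _ => ?_) (h2.trans (by split_ifs <;> simp))
      rw [← map_mul κ, hu, ht, map_mul (algebraMap M Ω), hm (τ * ρ), hm ρ]
      rfl
    · rw [if_neg (fun h => hb ⟨1, by rw [h, map_one]⟩)]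
      refine Finset.sum_eq_zero fun ρ _ => ?_
      rw [ht0, mul_zero]
      rintro ⟨ρ', h⟩
      exact hb ⟨ρ' * ρ⁻¹, by rw [map_mul, map_inv, h, mul_inv_cancel_right]⟩
  · by_cases hb : b ∈ Set.range κ
    · obtain ⟨ρ, rfl⟩ := hb
      rw [← hκ, ← map_mul, ht, ht, hm (r σ * ρ), hm ρ]
      exact (AlgEquiv.restrictNormal_commutes σ M _).symm
    · rw [ht0 b hb, map_zero, ht0]
      rintro ⟨ρ', h⟩
      exact hb ⟨(r σ)⁻¹ * ρ', by rw [map_mul, map_inv, hκ, h, inv_mul_cancel_left]⟩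

namespace NormalBasisAlgebra

section Descent

variable {K L R B : Type*} [Field K] [Field L] [Algebra K L] [FiniteDimensional K L] [IsGalois K L]
  [CommRing R] [Algebra K R] [Algebra L R] [IsScalarTower K L R] [Group B]
  [MulSemiringAction B R] [SMulCommClass B K R] {π : B →* Gal(L/K)}
  (hπ : Function.Surjective π)
  (hact : ∀ (b : B) (l : L), b • algebraMap L R l = algebraMap L R (π b l))

include hπ hact

omit [IsScalarTower K L R] in
/-- Galois descent: an element of `R` that is fixed by the kernel of `B → Gal(L / K)` is an
`L`-linear combination of elements fixed by `B`. -/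
theorem exists_eq_sum_smul_of_fixed {r : R} (hr : ∀ b, π b = 1 → b • r = r) :
    ∃ (l : Module.Free.ChooseBasisIndex K L → L)
      (s : Module.Free.ChooseBasisIndex K L → FixedPoints.subalgebra K R B),
      r = ∑ k, l k • (s k : R) := by
  classical
  let m := Module.Free.chooseBasis K L
  choose g hg using hπ
  -- The translates of `l • r` depend only on the image in the Galois group.
  have hindep : ∀ (l : L) (b c : B), π b = π c → b • (l • r) = c • (l • r) := by
    intro l b c h
    have h1 : (c⁻¹ * b) • r = r := hr _ (by rw [map_mul, map_inv, h, inv_mul_cancel])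
    have h2 : b • r = c • r := by
      conv_rhs => rw [← h1, smul_smul, mul_inv_cancel_left]
    rw [Algebra.smul_def, smul_mul', smul_mul', hact, hact, h, h2]
  refine ⟨fun k => m.traceDual k, fun k => ⟨∑ τ, g τ • (m k • r), fun b => ?_⟩, ?_⟩
  · rw [Finset.smul_sum]
    conv_rhs => rw [← Equiv.sum_comp (Equiv.mulLeft (π b))]
    refine Finset.sum_congr rfl fun τ _ => ?_
    rw [smul_smul]
    exact hindep _ _ _ (by simp [hg])
  · simp only [Finset.smul_sum]
    rw [Finset.sum_comm]
    have h2 : ∀ τ : Gal(L/K), ∑ k, m.traceDual k • g τ • (m k • r) =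
        (if τ = 1 then (1 : L) else 0) • g τ • r := by
      intro τ
      rw [← sum_traceDual_mul_apply m τ, Finset.sum_smul]
      refine Finset.sum_congr rfl fun k _ => ?_
      simp only [Algebra.smul_def, smul_mul', hact, hg, map_mul, mul_assoc]
    rw [Finset.sum_congr rfl fun τ _ => h2 τ]
    simp [hr (g 1) (hg 1)]

/-- Galois descent: elements of the ring of invariants that are linearly independent over `K`
remain so over `L`. -/
theorem injective_productMap :
    Function.Injective (Algebra.TensorProduct.productMap
      (IsScalarTower.toAlgHom K L R) (FixedPoints.subalgebra K R B).val) := by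
  classical
  let m := Module.Free.chooseBasis K L
  let f := Algebra.TensorProduct.productMap
      (IsScalarTower.toAlgHom K L R) (FixedPoints.subalgebra K R B).val
  choose g hg using hπ
  refine (injective_iff_map_eq_zero f).2 fun x hx => ?_
  obtain ⟨s, rfl⟩ : ∃ s : Module.Free.ChooseBasisIndex K L → FixedPoints.subalgebra K R B,
      x = ∑ k, m.traceDual k ⊗ₜ[K] s k := by
    obtain ⟨c, hc⟩ := TensorProduct.eq_repr_basis_left m.traceDual x
    exact ⟨c, by rw [← hc, Finsupp.sum_fintype _ _ (by simp)]⟩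
  have h1 : ∀ l : L, ∀ s : FixedPoints.subalgebra K R B, f (l ⊗ₜ s) = l • (s : R) := fun l s => by
    simp [f, Algebra.smul_def]
  rw [map_sum] at hx
  simp only [h1] at hx
  refine Finset.sum_eq_zero fun j _ => ?_
  have h2 : (s j : R) = 0 := by
    have h3 : ∑ τ, g τ • (m j • ∑ k, m.traceDual k • (s k : R)) = 0 := by simp [hx]
    rw [← h3]
    simp only [Finset.smul_sum]
    rw [Finset.sum_comm]
    have h4 : ∀ k, ∑ τ, g τ • (m j • m.traceDual k • (s k : R)) =
        (if j = k then (1 : K) else 0) • (s k : R) := by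
      intro k
      rw [← m.trace_mul_traceDual,
        ← algebraMap_smul L (Algebra.trace K L _) (s k : R), trace_eq_sum_automorphisms,
        Finset.sum_smul]
      refine Finset.sum_congr rfl fun τ _ => ?_
      rw [smul_smul, Algebra.smul_def, smul_mul', hact, hg, Algebra.smul_def]
      congr 1
      exact (s k).2 _
    rw [Finset.sum_congr rfl fun k _ => h4 k]
    simp
  rw [show s j = 0 from Subtype.ext h2, TensorProduct.tmul_zero]

end Descent

section Points

variable {K R B : Type*} [Field K] [CommRing R] [Algebra K R] [Group B]
  [Fintype B] [DecidableEq B] [MulSemiringAction B R] [SMulCommClass B K R]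
  {y : R} {u : B → R} (h : IsDualFamily (fun b : B => b • y) u)

include h

/-- `B` acts transitively on the points of `R` over a given point of the ring of invariants. -/
theorem exists_eq_smul {F : Type*} [Field F] (p q : R →+* F)
    (hpq : ∀ s : FixedPoints.subalgebra K R B, p s = q s) : ∃ b : B, ∀ r, q r = p (b • r) := by
  let ε : B → F := fun b => ∑ e, p (u (b * e)) * q (e • y)
  -- `q` is a linear combination of the translates of `p`, hence one of them by Dedekind.
  have h1 : ∀ r, q r = ∑ b, ε b * p (b • r) := by
    intro r
    have h2 : ∀ e, q (trace K R B (u e * r)) = ∑ b, p (u (b * e)) * p (b • r) := fun e => by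
      rw [← hpq, coe_trace, map_sum]
      exact Finset.sum_congr rfl fun b _ => by rw [smul_mul', smul_dual h, map_mul]
    conv_lhs => rw [← sum_trace_smul (K := K) h r]
    simp only [map_sum, Algebra.smul_def, map_mul]
    change ∑ e, q (trace K R B (u e * r)) * _ = _
    simp only [h2, ε, Finset.sum_mul]
    rw [Finset.sum_comm]
    exact Finset.sum_congr rfl fun b _ => Finset.sum_congr rfl fun e _ => by ring
  by_contra! hne
  let P : B → (R →* F) := fun b => (p.comp (MulSemiringAction.toRingHom B R b) : R →* F)
  have h3 := (linearIndependent_monoidHom R F).notMem_span_image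
    (s := Set.range P) (x := (q : R →* F)) (by
      rintro ⟨b, hb⟩
      obtain ⟨r, hr⟩ := hne b
      exact hr (DFunLike.congr_fun hb r).symm)
  apply h3
  have h4 : ((q : R →* F) : R → F) = ∑ b, ε b • (P b : R → F) := by
    ext r
    rw [Finset.sum_apply]
    exact h1 r
  rw [h4]
  exact Submodule.sum_mem _ fun b _ => Submodule.smul_mem _ _
    (Submodule.subset_span ⟨P b, ⟨b, rfl⟩, rfl⟩)

omit [Field K] [Algebra K R] [SMulCommClass B K R] in
/-- `B` acts freely on the points of `R`. -/
theorem eq_of_forall_smul_eq {F : Type*} [Field F] (p : R →+* F) {b c : B}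
    (hbc : ∀ r, p (b • r) = p (c • r)) : b = c := by
  have h1 : ∀ r, p ((b * c⁻¹) • r) = p r := fun r => by
    rw [mul_smul, hbc, smul_inv_smul]
  have h2 := congrArg p (h (b * c⁻¹))
  have h3 := congrArg p (h 1)
  rw [map_sum] at h2 h3
  have h4 : ∀ e, p (u e * (b * c⁻¹ * e) • y) = p (u e * (1 * e) • y) := fun e => by
    rw [map_mul, map_mul, mul_smul, h1, one_mul]
  rw [Finset.sum_congr rfl fun e _ => h4 e, h3] at h2
  by_contra hne
  rw [if_pos rfl, if_neg (fun h => hne (mul_inv_eq_one.1 h)), map_one, map_zero] at h2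
  exact one_ne_zero h2

/-- A rational point of the ring of invariants lifts to a point of `R` over a separable
closure. -/
theorem exists_lift {Ω : Type*} [Field Ω] [Algebra K Ω] [IsSepClosed Ω]
    [Algebra.FiniteType K R] (ψ : FixedPoints.subalgebra K R B →ₐ[K] K) :
    ∃ q : R →ₐ[K] Ω, ∀ s : FixedPoints.subalgebra K R B, q s = algebraMap K Ω (ψ s) := by
  let S := FixedPoints.subalgebra K R B
  let _ : Algebra S K := ψ.toRingHom.toAlgebra
  have : IsScalarTower K S K := .of_algebraMap_eq fun k => (ψ.commutes k).symm
  have := finite (K := K) h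
  have := free (K := K) h
  have := etale (K := K) h
  -- The fibre of `R` over the point `ψ`; it is étale over `K`, so its residue fields are separable.
  let E := K ⊗[S] R
  have hR : Nontrivial E := by
    have : Nontrivial S := RingHom.domain_nontrivial (ψ : S →+* K)
    have : Nontrivial R := Subtype.val_injective.nontrivial (α := S)
    have : Module.FaithfullyFlat S R := inferInstance
    infer_instance
  obtain ⟨I, hI⟩ := Ideal.exists_maximal E
  let _ : Field (E ⧸ I) := Ideal.Quotient.field I
  have : Algebra.FormallyUnramified K (E ⧸ I) :=
    .of_surjective (Ideal.Quotient.mkₐ K I) Ideal.Quotient.mk_surjective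
  have : Algebra.FiniteType K (E ⧸ I) :=
    .of_surjective (Ideal.Quotient.mkₐ K I) Ideal.Quotient.mk_surjective
  have : Algebra.IsSeparable K (E ⧸ I) := (Algebra.FormallyUnramified.iff_isSeparable _ _).1 ‹_›
  let f : E ⧸ I →ₐ[K] Ω := IsSepClosed.lift
  let i : R →+* E := (Algebra.TensorProduct.includeRight : R →ₐ[S] E)
  have hi : ∀ s : S, i s = algebraMap K E (ψ s) := fun s =>
    (Algebra.TensorProduct.includeRight : R →ₐ[S] E).commutes s
  let q : R →+* Ω := (f : E ⧸ I →+* Ω).comp ((Ideal.Quotient.mk I).comp i)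
  have hq : ∀ s : S, q s = algebraMap K Ω (ψ s) := fun s => by
    change f (Ideal.Quotient.mk I (i s)) = _
    rw [hi]
    exact f.commutes _
  have hqK : ∀ k : K, q (algebraMap K R k) = algebraMap K Ω k := fun k => by
    have := hq (algebraMap K S k)
    rwa [ψ.commutes] at this
  exact ⟨{ q with commutes' := hqK }, hq⟩

end Points

end NormalBasisAlgebra

/-! ### The torsor of normal bases -/

/-- If `k ⊗ P` is a domain, then so is its localization at an element of `P`. -/
theorem isDomain_tensorProduct_of_localization {L k P : Type*} [Field L] [Field k]
    [Algebra L k] [CommRing P] [Algebra L P] (d : P) (hd : d ∈ nonZeroDivisors P)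
    [IsDomain (k ⊗[L] P)] :
    IsDomain (k ⊗[L] Localization.Away d) := by
  let R := Localization.Away d
  let i : P →ₐ[L] R := IsScalarTower.toAlgHom L P R
  have hi : Function.Injective i :=
    IsLocalization.injective R (Submonoid.powers_le.2 hd)
  let j : k ⊗[L] P →ₐ[L] k ⊗[L] R := Algebra.TensorProduct.map (AlgHom.id L k) i
  have hj : Function.Injective j :=
    Module.Flat.lTensor_preserves_injective_linearMap (M := k) i.toLinearMap hi
  let c : R →ₐ[L] k ⊗[L] R := Algebra.TensorProduct.includeRight
  let δ : k ⊗[L] R := c (i d)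
  have hδ : IsUnit δ := (IsLocalization.Away.algebraMap_isUnit d).map c
  have hδj : ∀ n : ℕ, δ ^ n = j ((1 ⊗ₜ d) ^ n) := fun n => by
    rw [map_pow]
    rfl
  have h1 : ∀ x : k ⊗[L] R, ∃ (n : ℕ) (q : k ⊗[L] P), δ ^ n * x = j q := by
    intro x
    induction x with
    | zero => exact ⟨0, 0, by simp⟩
    | tmul a r =>
      obtain ⟨n, q, hq⟩ := IsLocalization.Away.surj d r
      refine ⟨n, a ⊗ₜ q, ?_⟩
      have h2 : δ ^ n = 1 ⊗ₜ (i d ^ n) := (map_pow c (i d) n).symm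
      rw [h2, Algebra.TensorProduct.tmul_mul_tmul, one_mul, mul_comm]
      exact congrArg (a ⊗ₜ[L] ·) hq
    | add x y hx hy =>
      obtain ⟨n, q, hq⟩ := hx
      obtain ⟨m, q', hq'⟩ := hy
      refine ⟨n + m, (1 ⊗ₜ d) ^ m * q + (1 ⊗ₜ d) ^ n * q', ?_⟩
      rw [map_add, map_mul, map_mul, ← hq, ← hq', ← hδj, ← hδj]
      ring
  have : Nontrivial (k ⊗[L] R) := hj.nontrivial
  have : NoZeroDivisors (k ⊗[L] R) := ⟨fun {x y} hxy => by
    obtain ⟨n, q, hq⟩ := h1 x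
    obtain ⟨m, q', hq'⟩ := h1 y
    have h2 : q * q' = 0 := by
      apply hj
      rw [map_mul, ← hq, ← hq', map_zero]
      linear_combination δ ^ n * δ ^ m * hxy
    rcases mul_eq_zero.1 h2 with h | h
    · left
      rwa [h, map_zero, (hδ.pow n).mul_right_eq_zero] at hq
    · right
      rwa [h, map_zero, (hδ.pow m).mul_right_eq_zero] at hq'⟩
  exact NoZeroDivisors.to_isDomain _

/-- The matrix `(X_{b e})` of variables indexed by a finite group. -/
noncomputable def groupMatrix (L B : Type*) [CommRing L] [Group B] :
    Matrix B B (MvPolynomial B L) :=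
  Matrix.of fun b e => MvPolynomial.X (b * e)

theorem det_groupMatrix_ne_zero (L B : Type*) [Field L] [Group B] [Fintype B] [DecidableEq B] :
    (groupMatrix L B).det ≠ 0 := by
  intro h
  have h1 := congrArg (MvPolynomial.eval fun b : B => if b = 1 then (1 : L) else 0) h
  rw [map_zero, RingHom.map_det] at h1
  have h2 : (IsDualFamily (fun b : B => if b = 1 then (1 : L) else 0)
      (fun b : B => if b = 1 then (1 : L) else 0)) := by
    intro b
    rw [Finset.sum_eq_single 1] <;> simp +contextual
  refine h2.isUnit_det.ne_zero ?_
  have h3 : (MvPolynomial.eval fun b : B => if b = 1 then (1 : L) else 0).mapMatrix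
      (groupMatrix L B) = Matrix.of fun b e : B => if b * e = 1 then (1 : L) else 0 := by
    ext b e
    rw [RingHom.mapMatrix_apply, Matrix.map_apply, groupMatrix, Matrix.of_apply, Matrix.of_apply,
      MvPolynomial.eval_X]
  rwa [h3] at h1

section Torsor

variable {K L B : Type*} [Field K] [Field L] [Algebra K L] [Group B] [Fintype B] [DecidableEq B]

/-- The coordinate ring, over `L`, of the space of functions `t : B → L` with
`det (t (b * e)) ≠ 0`, i.e. of those that have a dual family. The homomorphism
`π : B → Gal(L / K)` enters in the semilinear action of `B`. -/
def TorsorRing (_π : B →* Gal(L/K)) : Type _ := Localization.Away (groupMatrix L B).det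

namespace TorsorRing

variable (π : B →* Gal(L/K))

noncomputable instance : CommRing (TorsorRing π) :=
  inferInstanceAs (CommRing (Localization.Away (groupMatrix L B).det))

noncomputable instance : Algebra L (TorsorRing π) :=
  inferInstanceAs (Algebra L (Localization.Away (groupMatrix L B).det))

noncomputable instance : Algebra K (TorsorRing π) :=
  inferInstanceAs (Algebra K (Localization.Away (groupMatrix L B).det))

instance : IsScalarTower K L (TorsorRing π) :=
  inferInstanceAs (IsScalarTower K L (Localization.Away (groupMatrix L B).det))

/-- The universal function `B → R`. -/
noncomputable def X (b : B) : TorsorRing π :=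
  algebraMap (MvPolynomial B L) (Localization.Away (groupMatrix L B).det) (MvPolynomial.X b)

variable {π}

theorem ringHom_ext {T : Type*} [CommRing T] {f g : TorsorRing π →+* T}
    (hL : ∀ l, f (algebraMap L _ l) = g (algebraMap L _ l)) (hX : ∀ b, f (X π b) = g (X π b)) :
    f = g := by
  let f' : Localization.Away (groupMatrix L B).det →+* T := f
  let g' : Localization.Away (groupMatrix L B).det →+* T := g
  have h : f' = g' := IsLocalization.ringHom_ext (R := MvPolynomial B L)
    (Submonoid.powers (groupMatrix L B).det) (MvPolynomial.ringHom_ext hL hX)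
  exact h

variable (π) in
theorem exists_dual : ∃ u, IsDualFamily (X π) u := by
  refine IsDualFamily.exists_of_isUnit_det ?_
  have h1 : IsUnit (algebraMap (MvPolynomial B L) (Localization.Away (groupMatrix L B).det)
    (groupMatrix L B).det) := IsLocalization.Away.algebraMap_isUnit _
  rw [RingHom.map_det] at h1
  exact h1

variable (π) in
/-- The universal property of `TorsorRing`. -/
theorem exists_ringHom {T : Type*} [CommRing T] (f : L →+* T) {t u : B → T}
    (h : IsDualFamily t u) :
    ∃ p : TorsorRing π →+* T, (∀ l, p (algebraMap L _ l) = f l) ∧ ∀ b, p (X π b) = t b := by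
  let g : MvPolynomial B L →+* T := MvPolynomial.eval₂Hom f t
  have hg : IsUnit (g (groupMatrix L B).det) := by
    rw [RingHom.map_det]
    convert h.isUnit_det
    ext b e
    simp [groupMatrix, g]
  let p : Localization.Away (groupMatrix L B).det →+* T := IsLocalization.Away.lift _ hg
  have hp : ∀ q, p (algebraMap _ _ q) = g q := IsLocalization.Away.lift_eq _ hg
  refine ⟨p, fun l => ?_, fun b => ?_⟩
  · exact (hp (MvPolynomial.C l)).trans (by simp [g])
  · exact (hp (MvPolynomial.X b)).trans (by simp [g])

theorem exists_act (b : B) : ∃ p : TorsorRing π →+* TorsorRing π,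
    (∀ l, p (algebraMap L _ l) = algebraMap L _ (π b l)) ∧ ∀ e, p (X π e) = X π (b * e) := by
  obtain ⟨u, hu⟩ := exists_dual π
  exact exists_ringHom π ((algebraMap L _).comp (π b : L →+* L)) (hu.translate b)

/-- The semilinear action of `B` on `TorsorRing`, by left translation of the variables. -/
noncomputable def act : B →* (TorsorRing π →+* TorsorRing π) where
  toFun b := (exists_act b).choose
  map_one' := ringHom_ext (fun l => by rw [(exists_act 1).choose_spec.1]; simp)
    (fun e => by rw [(exists_act 1).choose_spec.2]; simp)
  map_mul' b c := ringHom_ext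
    (fun l => by
      rw [(exists_act (b * c)).choose_spec.1, RingHom.mul_def, RingHom.comp_apply,
        (exists_act c).choose_spec.1, (exists_act b).choose_spec.1, map_mul]
      rfl)
    (fun e => by
      rw [(exists_act (b * c)).choose_spec.2, RingHom.mul_def, RingHom.comp_apply,
        (exists_act c).choose_spec.2, (exists_act b).choose_spec.2, mul_assoc])

noncomputable instance : MulSemiringAction B (TorsorRing π) :=
  MulSemiringAction.compHom (TorsorRing π) (act (π := π))

theorem smul_algebraMap (b : B) (l : L) :
    b • algebraMap L (TorsorRing π) l = algebraMap L (TorsorRing π) (π b l) :=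
  (exists_act b).choose_spec.1 l

theorem smul_X (b e : B) : b • X π e = X π (b * e) := (exists_act b).choose_spec.2 e

instance : SMulCommClass B K (TorsorRing π) where
  smul_comm b k r := by
    rw [Algebra.smul_def, Algebra.smul_def, smul_mul',
      IsScalarTower.algebraMap_apply K L (TorsorRing π), smul_algebraMap, AlgEquiv.commutes]

variable (π) in
theorem exists_isDualFamily : ∃ u, IsDualFamily (fun b : B => b • X π 1) u := by
  simpa only [smul_X, mul_one] using exists_dual π

variable (π) in
theorem smooth [FiniteDimensional K L] [Algebra.IsSeparable K L] :
    Algebra.Smooth K (TorsorRing π) := by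
  have : Algebra.FormallySmooth L (Localization.Away (groupMatrix L B).det) :=
    Algebra.FormallySmooth.comp L (MvPolynomial B L) _
  have : Algebra.FormallyEtale K L := Algebra.FormallyEtale.of_isSeparable K L
  have h1 : Algebra.FormallySmooth K (Localization.Away (groupMatrix L B).det) :=
    Algebra.FormallySmooth.comp K L _
  have : Algebra.FiniteType (MvPolynomial B L) (Localization.Away (groupMatrix L B).det) :=
    IsLocalization.finiteType_of_monoid_fg (Submonoid.powers (groupMatrix L B).det) _
  have : Algebra.FiniteType L (Localization.Away (groupMatrix L B).det) :=
    Algebra.FiniteType.trans (S := MvPolynomial B L) inferInstance inferInstance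
  have h2 : Algebra.FiniteType K (Localization.Away (groupMatrix L B).det) :=
    Algebra.FiniteType.trans (S := L) inferInstance inferInstance
  exact ⟨h1, Algebra.FinitePresentation.of_finiteType.1 h2⟩

variable (π) in
theorem isDomain_tensorProduct (k : Type*) [Field k] [Algebra L k] :
    IsDomain (k ⊗[L] TorsorRing π) := by
  have : IsDomain (k ⊗[L] MvPolynomial B L) :=
    (MvPolynomial.algebraTensorAlgEquiv L k).toMulEquiv.isDomain _
  exact isDomain_tensorProduct_of_localization (groupMatrix L B).det
    (mem_nonZeroDivisors_of_ne_zero (det_groupMatrix_ne_zero L B))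

/-- The ring of invariants of `TorsorRing` is geometrically integral over `K`. -/
theorem isDomain_tensorProduct_fixedPoints [FiniteDimensional K L] [IsGalois K L]
    (hπ : Function.Surjective π) (k : Type*) [Field k] [Algebra K k] [IsAlgClosed k] :
    IsDomain (k ⊗[K] FixedPoints.subalgebra K (TorsorRing π) B) := by
  let i : L →ₐ[K] k := IsAlgClosed.lift
  let _ : Algebra L k := i.toRingHom.toAlgebra
  have : IsScalarTower K L k := .of_algebraMap_eq' i.comp_algebraMap.symm
  let S := FixedPoints.subalgebra K (TorsorRing π) B
  have h1 := NormalBasisAlgebra.injective_productMap (K := K) hπ (smul_algebraMap (π := π))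
  let f : L ⊗[K] S →ₐ[L] TorsorRing π :=
    Algebra.TensorProduct.productLeftAlgHom (Algebra.ofId L (TorsorRing π)) S.val
  have hf : Function.Injective f := by
    convert h1
    ext x
    induction x with
    | zero => simp
    | tmul l s => simp [f, Algebra.ofId_apply]
    | add x y hx hy => rw [map_add, map_add, hx, hy]
  let g : k ⊗[L] (L ⊗[K] S) →ₐ[k] k ⊗[L] TorsorRing π :=
    Algebra.TensorProduct.map (AlgHom.id k k) f
  have hg : Function.Injective g :=
    Module.Flat.lTensor_preserves_injective_linearMap (M := k) f.toLinearMap hf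
  have := isDomain_tensorProduct π k
  have h2 : IsDomain (k ⊗[L] (L ⊗[K] S)) := hg.isDomain g.toRingHom
  exact (Algebra.TensorProduct.cancelBaseChange K L k k S).symm.toMulEquiv.isDomain _

end TorsorRing

end Torsor

/-! ### Approximation of points of the torsor -/

open Polynomial in
/-- If the coefficients of a monic polynomial that splits agree with those of `(X - 1) X ^ r` modulo
the maximal ideal of a valuation ring, then exactly one root is congruent to `1`: both polynomials
have the same reduction, and the roots are integral. -/
theorem existsUnique_valuation_sub_one_lt {Ω N : Type*} [Field Ω] [Fintype N] [DecidableEq N]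
    (W : ValuationSubring Ω) (θ : N → Ω) (n₀ : N)
    (h : ∀ k, W.valuation ((∏ n, (Polynomial.X - Polynomial.C (θ n))).coeff k -
      (∏ n, (Polynomial.X - Polynomial.C (if n = n₀ then (1 : Ω) else 0))).coeff k) < 1) :
    ∃! n, W.valuation (θ n - 1) < 1 := by
  classical
  let P : Polynomial Ω := ∏ n, (X - C (θ n))
  let P' : Polynomial Ω := ∏ n, (X - C (if n = n₀ then (1 : Ω) else 0))
  let Q' : W[X] := ∏ n, (X - C (if n = n₀ then (1 : W) else 0))
  have hQ' : Q'.map W.subtype = P' := by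
    simp only [Q', P', Polynomial.map_prod, Polynomial.map_sub, Polynomial.map_X,
      Polynomial.map_C]
    refine Finset.prod_congr rfl fun n _ => ?_
    congr 2
    split_ifs <;> simp
  have hmem : ∀ k, P.coeff k ∈ W.toSubring := by
    intro k
    have h1 : P'.coeff k ∈ W := by
      rw [← hQ', coeff_map]
      exact (Q'.coeff k).2
    have h2 : P.coeff k - P'.coeff k ∈ W := (W.valuation_le_one_iff _).1 (h k).le
    have := W.add_mem _ _ h2 h1
    rwa [sub_add_cancel] at this
  have hθ : ∀ n, θ n ∈ W := by
    intro n
    have hmonic : P.Monic := monic_prod_of_monic _ _ fun n _ => monic_X_sub_C _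
    have hsub : (P.coeffs : Set Ω) ⊆ W.toSubring := by
      intro x hx
      obtain ⟨k, _, rfl⟩ := Polynomial.mem_coeffs_iff.1 hx
      exact hmem k
    have h2 : (P.toSubring W.toSubring hsub).map W.toSubring.subtype = P :=
      Polynomial.map_toSubring P W.toSubring hsub
    have h1 : IsIntegral W (θ n) := by
      refine ⟨P.toSubring W.toSubring hsub, (Polynomial.monic_toSubring _ _ _).2 hmonic, ?_⟩
      change eval₂ W.toSubring.subtype (θ n) _ = 0
      rw [eval₂_eq_eval_map]
      refine (congrArg (eval (θ n)) h2).trans ?_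
      rw [eval_prod]
      exact Finset.prod_eq_zero (Finset.mem_univ n) (by simp)
    obtain ⟨z, hz⟩ := IsIntegrallyClosed.isIntegral_iff.1 h1
    rw [← hz]
    exact z.2
  let Q : W[X] := ∏ n, (X - C (⟨θ n, hθ n⟩ : W))
  have hQ : Q.map W.subtype = P := by
    simp only [Q, P, Polynomial.map_prod, Polynomial.map_sub, Polynomial.map_X,
      Polynomial.map_C]
    rfl
  let ρ := IsLocalRing.residue W
  have h3 : Q.map ρ = Q'.map ρ := by
    ext k
    rw [coeff_map, coeff_map, ← sub_eq_zero, ← map_sub, IsLocalRing.residue_eq_zero_iff,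
      W.valuation_lt_one_iff]
    have := h k
    change W.valuation (P.coeff k - P'.coeff k) < 1 at this
    rw [← hQ, ← hQ', coeff_map, coeff_map, ← map_sub] at this
    exact this
  have h4 : (Finset.univ.val.map fun n => ρ ⟨θ n, hθ n⟩) =
      Finset.univ.val.map fun n => ρ (if n = n₀ then (1 : W) else 0) := by
    have h5 : ∀ f : N → W, ((∏ n, (X - C (f n))).map ρ).roots =
        Finset.univ.val.map fun n => ρ (f n) := by
      intro f
      have : (∏ n, (X - C (f n))).map ρ = ((Finset.univ.val.map fun n => ρ (f n)).map
          fun a => X - C a).prod := by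
        rw [Polynomial.map_prod, Multiset.map_map]
        exact Finset.prod_congr rfl fun n _ => by simp
      rw [this, roots_multiset_prod_X_sub_C]
    rw [← h5, ← h5]
    exact congrArg roots h3
  have h6 := congrArg (Multiset.count 1) h4
  have h7 : ∀ n, ρ ⟨θ n, hθ n⟩ = 1 ↔ W.valuation (θ n - 1) < 1 := by
    intro n
    rw [← map_one ρ, ← sub_eq_zero, ← map_sub, IsLocalRing.residue_eq_zero_iff,
      W.valuation_lt_one_iff]
    rfl
  rw [Multiset.count_map, Multiset.count_map] at h6
  have h8 : (Finset.univ.filter fun n => 1 = ρ ⟨θ n, hθ n⟩).card =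
      (Finset.univ.filter fun n => 1 = ρ (if n = n₀ then (1 : W) else 0)).card := h6
  have h9 : (Finset.univ.filter fun n => 1 = ρ (if n = n₀ then (1 : W) else 0)) = {n₀} := by
    ext n
    simp only [Finset.mem_filter, Finset.mem_univ, true_and, Finset.mem_singleton]
    split_ifs with hn <;> simp [hn]
  rw [h9, Finset.card_singleton, Finset.card_eq_one] at h8
  obtain ⟨m, hm⟩ := h8
  have h10 : ∀ n, W.valuation (θ n - 1) < 1 ↔ n = m := by
    intro n
    rw [← h7]
    simpa [eq_comm] using Finset.ext_iff.1 hm n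
  exact ⟨m, (h10 m).2 rfl, fun n hn => (h10 n).1 hn⟩

namespace NormalBasisAlgebra

variable {K L R B Ω : Type*} [Field K] [Field L] [Algebra K L]
  [CommRing R] [Algebra K R] [Algebra L R] [IsScalarTower K L R] [Group B] [Fintype B]
  [MulSemiringAction B R] [Field Ω] [Algebra L Ω]

/-- The comparison function of two points `p₀` and `p` of `R`: if `u` is the dual family of the
orbit of `y` and both points lie over the same point of the ring of invariants, then it is the
indicator function of the element `b` with `p (b • r) = p₀ r` for all `r`. -/
def comparison (y : R) (u : B → R) (p₀ p : R →ₐ[L] Ω) (b : B) : Ω :=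
  ∑ e, p₀ (u e) * p (b • e • y)

/-- If `σ` acts on the points `p₀` and `p` through `g₀` and `g`, then it acts on the comparison
function by `b ↦ g b g₀⁻¹`. -/
theorem apply_comparison [DecidableEq B] {y : R} {u : B → R}
    (h : IsDualFamily (fun b : B => b • y) u) {p₀ p : R →ₐ[L] Ω} {F : Type*} [FunLike F Ω Ω]
    [RingHomClass F Ω Ω] (σ : F) {g₀ g : B} (h₀ : ∀ r, σ (p₀ r) = p₀ (g₀ • r))
    (hp : ∀ r, σ (p r) = p (g • r)) (b : B) :
    σ (comparison y u p₀ p b) = comparison y u p₀ p (g * b * g₀⁻¹) := by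
  rw [comparison, comparison, map_sum]
  conv_rhs => rw [← Equiv.sum_comp (Equiv.mulLeft g₀)]
  refine Finset.sum_congr rfl fun e _ => ?_
  rw [map_mul, h₀, hp, smul_dual h]
  simp [smul_smul, mul_assoc]

/-- The elements `r` of `R` with the following property: for every factor `h` there are finitely
many elements `d` such that, for every valuation ring `W` and every `c` with all `d * c` in `W`,
each point `p` that is closer than `c` to `p₀` on the family `s` satisfies `h * (p r - p₀ r) ∈ 𝔪_W`. The
factor `h` makes this property stable under products. -/
def approximable {ι : Type*} (s : ι → R) (p₀ : R →ₐ[L] Ω) : Subalgebra L R where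
  carrier := {r | ∀ h : Ω, ∃ D : Finset Ω, ∀ (W : ValuationSubring Ω) (c : Ω),
    (∀ d ∈ D, d * c ∈ W) → ∀ p : R →ₐ[L] Ω,
      (∀ k, W.valuation (p (s k) - p₀ (s k)) < W.valuation c) →
        W.valuation (h * (p r - p₀ r)) < 1}
  algebraMap_mem' l h := ⟨∅, fun W c _ p _ => by
    rw [AlgHom.commutes, AlgHom.commutes, sub_self, mul_zero, map_zero]
    exact zero_lt_one⟩
  add_mem' {r r'} hr hr' h := by
    classical
    obtain ⟨D, hD⟩ := hr h
    obtain ⟨D', hD'⟩ := hr' h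
    refine ⟨D ∪ D', fun W c hc p hp => ?_⟩
    have h1 := hD W c (fun d hd => hc d (Finset.mem_union_left _ hd)) p hp
    have h2 := hD' W c (fun d hd => hc d (Finset.mem_union_right _ hd)) p hp
    have h3 := W.valuation.map_add_lt h1 h2
    rw [map_add, map_add]
    convert h3 using 2
    ring
  mul_mem' {r r'} hr hr' h := by
    classical
    obtain ⟨D₁, hD₁⟩ := hr (h * p₀ r')
    obtain ⟨D₂, hD₂⟩ := hr' (h * p₀ r)
    obtain ⟨D₃, hD₃⟩ := hr h
    obtain ⟨D₄, hD₄⟩ := hr' 1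
    refine ⟨D₁ ∪ D₂ ∪ (D₃ ∪ D₄), fun W c hc p hp => ?_⟩
    have h1 := hD₁ W c (fun d hd => hc d (by simp [hd])) p hp
    have h2 := hD₂ W c (fun d hd => hc d (by simp [hd])) p hp
    have h3 := hD₃ W c (fun d hd => hc d (by simp [hd])) p hp
    have h4 := hD₄ W c (fun d hd => hc d (by simp [hd])) p hp
    have h5 : W.valuation (h * (p r - p₀ r) * (1 * (p r' - p₀ r'))) < 1 := by
      rw [map_mul]
      exact mul_lt_one' h3 h4
    have h6 := W.valuation.map_add_lt (W.valuation.map_add_lt h1 h2) h5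
    rw [map_mul p, map_mul p₀]
    convert h6 using 2
    ring

theorem mem_approximable {ι : Type*} (s : ι → R) (p₀ : R →ₐ[L] Ω) (k : ι) :
    s k ∈ approximable s p₀ := by
  intro h
  refine ⟨{h}, fun W c hc p hp => ?_⟩
  rcases eq_or_ne h 0 with rfl | hh
  · simp
  have h1 : W.valuation (h * c) ≤ 1 := (W.valuation_le_one_iff _).2 (hc h (by simp))
  refine lt_of_lt_of_le ?_ h1
  rw [map_mul, map_mul]
  exact mul_lt_mul_of_pos_left (hp k) ((Valuation.pos_iff _).2 hh)

variable [DecidableEq B] [SMulCommClass B K R] [FiniteDimensional K L] [IsGalois K L]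
  {π : B →* Gal(L/K)} (hπ : Function.Surjective π)
  (hact : ∀ (b : B) (l : L), b • algebraMap L R l = algebraMap L R (π b l))
  {y : R} {u : B → R} (h : IsDualFamily (fun b : B => b • y) u)

include hπ hact h

omit [Fintype B] [DecidableEq B] h in
theorem mem_approximable_of_fixed {ι : Type*} (s : ι → FixedPoints.subalgebra K R B)
    (hs : Algebra.adjoin K (Set.range s) = ⊤) (p₀ : R →ₐ[L] Ω) {r : R}
    (hr : ∀ b, π b = 1 → b • r = r) : r ∈ approximable (fun k => (s k : R)) p₀ := by
  obtain ⟨l, t, rfl⟩ := exists_eq_sum_smul_of_fixed hπ hact hr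
  refine sum_mem fun k _ => Subalgebra.smul_mem _ ?_ _
  let A : Subalgebra K R := (approximable (fun k => (s k : R)) p₀).restrictScalars K
  have h1 : Algebra.adjoin K (Set.range s) ≤ A.comap (FixedPoints.subalgebra K R B).val :=
    Algebra.adjoin_le (by
      rintro _ ⟨k, rfl⟩
      exact mem_approximable (fun k => (s k : R)) p₀ k)
  rw [hs] at h1
  exact h1 (x := t k) trivial

/-- Krasner's lemma for torsors: if a point `p` of `R` is sufficiently close to `p₀` on generators
of the ring of invariants, then exactly one of the values of the comparison function on the kernel
of `B → Gal(L / K)` is close to `1`. -/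
theorem exists_finset_existsUnique_comparison {ι : Type*} (s : ι → FixedPoints.subalgebra K R B)
    (hs : Algebra.adjoin K (Set.range s) = ⊤) (p₀ : R →ₐ[L] Ω) :
    ∃ D : Finset Ω, ∀ (W : ValuationSubring Ω) (c : Ω), (∀ d ∈ D, d * c ∈ W) →
      ∀ p : R →ₐ[L] Ω, (∀ k, W.valuation (p (s k) - p₀ (s k)) < W.valuation c) →
        ∃! n : π.ker, W.valuation (comparison y u p₀ p (n : B) - 1) < 1 := by
  classical
  -- The polynomial whose roots are the values of the comparison function, with indeterminates in
  -- place of the values of `p₀`; its coefficients are fixed by the kernel.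
  let Q : Polynomial (MvPolynomial B R) := ∏ n : π.ker, (Polynomial.X - Polynomial.C
    (∑ e, MvPolynomial.X e * MvPolynomial.C ((n : B) • e • y)))
  have hQ : ∀ k m (b : B), π b = 1 → b • (Q.coeff k).coeff m = (Q.coeff k).coeff m := by
    intro k m b hb
    let f : MvPolynomial B R →+* MvPolynomial B R :=
      MvPolynomial.map (MulSemiringAction.toRingHom B R b)
    have h1 : Q.map f = Q := by
      simp only [Q, Polynomial.map_prod, Polynomial.map_sub, Polynomial.map_X, Polynomial.map_C]
      conv_rhs => rw [← Equiv.prod_comp (Equiv.mulLeft (⟨b, hb⟩ : π.ker))]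
      refine Finset.prod_congr rfl fun n _ => ?_
      congr 2
      rw [map_sum]
      refine Finset.sum_congr rfl fun e _ => ?_
      simp [f, smul_smul, mul_assoc]
    conv_rhs => rw [← h1]
    rw [Polynomial.coeff_map, MvPolynomial.coeff_map]
    rfl
  let v : B → Ω := fun e => p₀ (u e)
  let ev : (R →ₐ[L] Ω) → MvPolynomial B R →+* Ω := fun p => MvPolynomial.eval₂Hom (p : R →+* Ω) v
  have hev : ∀ p, Q.map (ev p) =
      ∏ n : π.ker, (Polynomial.X - Polynomial.C (comparison y u p₀ p (n : B))) := by
    intro p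
    simp only [Q, Polynomial.map_prod, Polynomial.map_sub, Polynomial.map_X, Polynomial.map_C]
    refine Finset.prod_congr rfl fun n _ => ?_
    simp [ev, comparison, v]
  have hev₀ : Q.map (ev p₀) =
      ∏ n : π.ker, (Polynomial.X - Polynomial.C (if n = 1 then (1 : Ω) else 0)) := by
    rw [hev]
    refine Finset.prod_congr rfl fun n _ => ?_
    congr 2
    have h1 := congrArg p₀ (h n)
    rw [map_sum] at h1
    rw [comparison]
    refine Eq.trans (Finset.sum_congr rfl fun e _ => ?_) (h1.trans ?_)
    · rw [map_mul, smul_smul]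
    · rw [apply_ite p₀, map_one, map_zero]
      simp
  choose D hD using fun (k : ℕ) (m : B →₀ ℕ) =>
    mem_approximable_of_fixed hπ hact s hs p₀ (hQ k m) (m.prod fun e i => v e ^ i)
  refine ⟨(Finset.range (Q.natDegree + 1)).biUnion fun k => (Q.coeff k).support.biUnion (D k),
    fun W c hc p hp => existsUnique_valuation_sub_one_lt W _ 1 fun k => ?_⟩
  rw [← hev, ← hev₀, Polynomial.coeff_map, Polynomial.coeff_map]
  have h2 : ∀ p : R →ₐ[L] Ω, ev p (Q.coeff k) =
      ∑ m ∈ (Q.coeff k).support, p ((Q.coeff k).coeff m) * m.prod fun e i => v e ^ i :=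
    fun p => MvPolynomial.eval₂_eq' _ _ _ |>.trans (by
      refine Finset.sum_congr rfl fun m _ => ?_
      rw [Finsupp.prod_fintype _ _ (by simp)]
      rfl)
  rw [h2, h2, ← Finset.sum_sub_distrib]
  refine Valuation.map_sum_lt _ one_ne_zero fun m hm => ?_
  rw [← sub_mul, mul_comm]
  refine hD k m W c (fun d hd => hc d ?_) p hp
  refine Finset.mem_biUnion.2 ⟨k, ?_, Finset.mem_biUnion.2 ⟨m, hm, hd⟩⟩
  rw [Finset.mem_range, Nat.lt_succ_iff]
  refine Polynomial.le_natDegree_of_ne_zero fun h0 => ?_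
  rw [h0] at hm
  simp at hm

end NormalBasisAlgebra

/-! ### Points of the torsor and Galois homomorphisms -/

/-- A geometrically integral smooth algebra of finite type is the coordinate ring of a smooth
absolutely irreducible affine variety. -/
theorem isSmoothAbsIrredVariety_ker_aeval {K S : Type*} [Field K] [CommRing S] [Algebra K S]
    [Algebra.Smooth K S] (hS : IsDomain (AlgebraicClosure K ⊗[K] S)) {n : ℕ} (s : Fin n → S)
    (hs : Function.Surjective (MvPolynomial.aeval (R := K) s)) :
    IsSmoothAbsIrredVariety K (RingHom.ker (MvPolynomial.aeval (R := K) s)) := by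
  let e := Ideal.quotientKerAlgEquivOfSurjective hs
  refine ⟨.of_equiv e.symm, ?_⟩
  exact (Algebra.TensorProduct.congr (AlgEquiv.refl (R := K) (A₁ := AlgebraicClosure K))
    e).toMulEquiv.isDomain _

theorem isRationalPoint_ker_aeval {K S F : Type*} [Field K] [CommRing S] [Algebra K S]
    [Field F] [Algebra K F] {n : ℕ} (s : Fin n → S) {a : Fin n → F} (f : S →ₐ[K] F)
    (ha : ∀ k, f (s k) = a k) :
    IsRationalPoint (RingHom.ker (MvPolynomial.aeval (R := K) s)) a := by
  intro q hq
  have h1 : MvPolynomial.aeval a = f.comp (MvPolynomial.aeval s) :=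
    MvPolynomial.algHom_ext fun k => by simp [ha]
  rw [h1, AlgHom.comp_apply, (RingHom.mem_ker).1 hq, map_zero]

theorem exists_algHom_of_isRationalPoint {K S F : Type*} [Field K] [CommRing S] [Algebra K S]
    [Field F] [Algebra K F] {n : ℕ} (s : Fin n → S)
    (hs : Function.Surjective (MvPolynomial.aeval (R := K) s)) {a : Fin n → F}
    (ha : IsRationalPoint (RingHom.ker (MvPolynomial.aeval (R := K) s)) a) :
    ∃ f : S →ₐ[K] F, ∀ k, f (s k) = a k := by
  let e := Ideal.quotientKerAlgEquivOfSurjective hs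
  let g := Ideal.Quotient.liftₐ (RingHom.ker (MvPolynomial.aeval (R := K) s))
    (MvPolynomial.aeval a) ha
  refine ⟨g.comp e.symm, fun k => ?_⟩
  have h1 : e.symm (s k) = Ideal.Quotient.mk _ (MvPolynomial.X k) := by
    rw [AlgEquiv.symm_apply_eq]
    exact (MvPolynomial.aeval_X s k).symm
  change g (e.symm (s k)) = _
  rw [h1]
  exact MvPolynomial.aeval_X a k

/-- Restricting scalars from an intermediate field is continuous for the Krull topologies. -/
theorem continuous_restrictScalars {K Ω : Type*} [Field K] [Field Ω] [Algebra K Ω]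
    [Algebra.IsIntegral K Ω] (F : IntermediateField K Ω) :
    Continuous fun σ : Gal(Ω/F) => σ.restrictScalars K := by
  let f : Gal(Ω/F) →* Gal(Ω/K) := MonoidHom.mk' (fun σ => σ.restrictScalars K) fun _ _ => rfl
  have : Algebra.IsIntegral F Ω := Algebra.IsIntegral.tower_top K
  refine continuous_of_continuousAt_one f ?_
  rw [ContinuousAt, map_one]
  intro V hV
  rw [krullTopology_mem_nhds_one_iff] at hV
  obtain ⟨E, hE, hEV⟩ := hV
  let b := Module.finBasis K E
  have h1 : IsOpen (⋂ i, (MulAction.stabilizer Gal(Ω/F) (b i : Ω) : Set Gal(Ω/F))) :=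
    isOpen_iInter_of_finite fun i => stabilizer_isOpen_of_isIntegral _
  rw [Filter.mem_map]
  refine Filter.mem_of_superset (h1.mem_nhds (Set.mem_iInter.2 fun i => one_smul _ _))
    fun σ hσ => hEV fun x => ?_
  have h2 : (f σ : Ω →ₐ[K] Ω).toLinearMap ∘ₗ E.val.toLinearMap = E.val.toLinearMap :=
    b.ext fun i => Set.mem_iInter.1 hσ i
  exact DFunLike.congr_fun h2 x

namespace TorsorRing

variable {K Ks B : Type*} [Field K] [Field Ks] [Algebra K Ks]
  [Group B] [Fintype B] [DecidableEq B] {L : IntermediateField K Ks} {π : B →* Gal(L/K)}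

/-- A homomorphism from an open subgroup of the Galois group to `B` that lifts the restriction to
`L` comes from a point of the torsor. -/
theorem exists_point_of_hom [IsGalois K Ks] (U : Subgroup Gal(Ks/K)) (γ : U →* B)
    (hγ : IsOpen ((γ.ker.map U.subtype : Subgroup Gal(Ks/K)) : Set Gal(Ks/K)))
    (hπγ : ∀ (σ : U) (l : L), (π (γ σ) l : Ks) = (σ : Gal(Ks/K)) l) :
    ∃ p : TorsorRing π →ₐ[L] Ks, ∀ (σ : U) r, (σ : Gal(Ks/K)) (p r) = p (γ σ • r) := by
  have hU : IsClosed (U : Set Gal(Ks/K)) :=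
    Subgroup.isClosed_of_isOpen _ (Subgroup.isOpen_mono (by
      rintro _ ⟨σ, _, rfl⟩
      exact σ.2) hγ)
  let F := IntermediateField.fixedField U
  have hF : F.fixingSubgroup = U := InfiniteGalois.fixingSubgroup_fixedField ⟨U, hU⟩
  have hmem : ∀ σ : Gal(Ks/F), σ.restrictScalars K ∈ U := fun σ => by
    rw [← hF]
    exact fun x => σ.commutes x
  let ι : Gal(Ks/F) →* U := MonoidHom.mk' (fun σ => ⟨σ.restrictScalars K, hmem σ⟩) fun _ _ => rfl
  have hι : ∀ σ : U, ∃ τ, ι τ = σ := fun σ => by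
    have : (σ : Gal(Ks/K)) ∈ F.fixingSubgroup := by
      rw [hF]
      exact σ.2
    exact ⟨IntermediateField.fixingSubgroupEquiv F ⟨σ, this⟩, rfl⟩
  obtain ⟨t, u, htu, ht⟩ := exists_isDualFamily_of_galois (γ.comp ι) (by
    convert hγ.preimage (continuous_restrictScalars F)
    ext σ
    constructor
    · intro h
      exact ⟨ι σ, h, rfl⟩
    · rintro ⟨τ, hτ, h⟩
      have : ι σ = τ := Subtype.ext h.symm
      change γ (ι σ) = 1
      rw [this]
      exact hτ)
  obtain ⟨p, hpL, hpX⟩ := exists_ringHom π (algebraMap L Ks) htu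
  refine ⟨{ p with commutes' := hpL }, fun σ r => ?_⟩
  obtain ⟨τ, rfl⟩ := hι σ
  change (ι τ : Gal(Ks/K)) (p r) = p (γ (ι τ) • r)
  have h1 : ((ι τ : Gal(Ks/K)) : Ks →+* Ks).comp p =
      p.comp (MulSemiringAction.toRingHom B (TorsorRing π) (γ (ι τ))) := by
    refine ringHom_ext (fun l => ?_) (fun b => ?_)
    · change (ι τ : Gal(Ks/K)) (p _) = p (γ (ι τ) • _)
      rw [smul_algebraMap, hpL, hpL]
      exact (hπγ _ _).symm
    · change (ι τ : Gal(Ks/K)) (p _) = p (γ (ι τ) • _)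
      rw [smul_X, hpX, hpX]
      exact ht τ b
  exact DFunLike.congr_fun h1 r

/-- A rational point of the ring of invariants lifts to a point of the torsor, and yields a
homomorphism from the Galois group to `B`. -/
theorem exists_point_of_rational [IsSepClosure K Ks] [FiniteDimensional K L] [IsGalois K L]
    (hπ : Function.Surjective π)
    (ψ : FixedPoints.subalgebra K (TorsorRing π) B →ₐ[K] K) :
    ∃ (p : TorsorRing π →ₐ[L] Ks) (γ : Gal(Ks/K) →* B),
      (∀ s : FixedPoints.subalgebra K (TorsorRing π) B, p s = algebraMap K Ks (ψ s)) ∧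
      (∀ σ r, σ (p r) = p (γ σ • r)) ∧ IsOpen (γ.ker : Set Gal(Ks/K)) := by
  have : IsSepClosed Ks := IsSepClosure.sep_closed K
  have : Algebra.IsSeparable K Ks := IsSepClosure.separable
  obtain ⟨u, hu⟩ := exists_isDualFamily π
  have := smooth π
  have : Algebra.FiniteType K (TorsorRing π) := inferInstance
  obtain ⟨q, hq⟩ := NormalBasisAlgebra.exists_lift (Ω := Ks) hu ψ
  obtain ⟨b, hb⟩ : ∃ b, ∀ l, q (b • algebraMap L _ l) = (l : Ks) := by
    let τ : Gal(L/K) := Normal.algHomEquivAut K Ks L (q.comp (IsScalarTower.toAlgHom K L _))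
    have hτ : ∀ l, (τ l : Ks) = q (algebraMap L _ l) := by
      intro l
      have := Equiv.symm_apply_apply (Normal.algHomEquivAut K Ks L)
        (q.comp (IsScalarTower.toAlgHom K L _))
      exact DFunLike.congr_fun this l
    obtain ⟨b, hb⟩ := hπ τ⁻¹
    refine ⟨b, fun l => ?_⟩
    rw [smul_algebraMap, ← hτ, hb]
    congr 1
    exact τ.apply_symm_apply l
  let p : TorsorRing π →ₐ[L] Ks :=
    { (q : TorsorRing π →+* Ks).comp (MulSemiringAction.toRingHom B _ b) with commutes' := hb }
  have hp : ∀ s : FixedPoints.subalgebra K (TorsorRing π) B, p s = algebraMap K Ks (ψ s) := by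
    intro s
    rw [← hq]
    exact congrArg q (s.2 b)
  have h1 : ∀ σ : Gal(Ks/K), ∃ g : B, ∀ r, σ (p r) = p (g • r) := fun σ =>
    NormalBasisAlgebra.exists_eq_smul (K := K) hu (p : TorsorRing π →+* Ks)
      ((σ : Ks →+* Ks).comp (p : TorsorRing π →+* Ks)) fun s => by
        change p s = σ (p s)
        rw [hp, AlgEquiv.commutes]
  choose γ hγ using h1
  have h2 : ∀ {b c : B}, (∀ r, p (b • r) = p (c • r)) → b = c := fun h =>
    NormalBasisAlgebra.eq_of_forall_smul_eq hu (p : TorsorRing π →+* Ks) h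
  let γ' : Gal(Ks/K) →* B := MonoidHom.mk' γ fun σ τ => h2 fun r => by
    rw [← hγ, AlgEquiv.mul_apply, hγ, hγ, mul_smul]
  refine ⟨p, γ', hp, hγ, ?_⟩
  have h3 : IsOpen (⋂ b, (MulAction.stabilizer Gal(Ks/K) (p (X π b)) : Set Gal(Ks/K))) :=
    isOpen_iInter_of_finite fun b => stabilizer_isOpen_of_isIntegral _
  have h4 := h3.inter L.fixingSubgroup_isOpen
  refine Subgroup.isOpen_of_mem_nhds _ (g := 1)
    (Filter.mem_of_superset (h4.mem_nhds (by simp [one_mem])) fun σ hσ => ?_)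
  change γ σ = 1
  refine h2 fun r => ?_
  rw [← hγ, one_smul]
  have h5 : (σ : Ks →+* Ks).comp (p : TorsorRing π →+* Ks) = p := by
    refine ringHom_ext (fun l => ?_) (fun b => ?_)
    · change σ (p (algebraMap L _ l)) = p (algebraMap L _ l)
      rw [AlgHom.commutes]
      exact hσ.2 l
    · exact Set.mem_iInter.1 hσ.1 b
  exact DFunLike.congr_fun h5 r

end TorsorRing

/-! ### Henselian valuations on the separable closure -/

theorem ValuationSubring.valuation_le_valuation_iff {F : Type*} [Field F] (W : ValuationSubring F)
    {a : F} (ha : a ≠ 0) (c : F) : W.valuation c ≤ W.valuation a ↔ c / a ∈ W := by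
  rw [← W.valuation_le_one_iff, map_div₀, div_le_one₀ ((Valuation.pos_iff _).2 ha)]

theorem ValuationSubring.valuation_lt_one_iff_inv_notMem {F : Type*} [Field F]
    (W : ValuationSubring F) {z : F} (hz : z ≠ 0) : W.valuation z < 1 ↔ z⁻¹ ∉ W := by
  rw [← not_le, ← map_one W.valuation, W.valuation_le_valuation_iff hz, one_div]

theorem ValuationSubring.valuation_lt_iff_of_comap {k F : Type*} [Field k] [Field F] [Algebra k F]
    {O : ValuationSubring k} {W : ValuationSubring F}
    (h : ∀ a, algebraMap k F a ∈ W ↔ a ∈ O) (a c : k) :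
    W.valuation (algebraMap k F a) < W.valuation (algebraMap k F c) ↔
      O.valuation a < O.valuation c := by
  rcases eq_or_ne a 0 with rfl | ha
  · simp only [map_zero, Valuation.pos_iff, ne_eq, map_eq_zero]
  rw [← not_le, ← not_le, O.valuation_le_valuation_iff ha,
    W.valuation_le_valuation_iff (by simpa using ha), ← map_div₀, h]

/-- Every finite set of elements that are algebraic over `K` becomes integral for a given valuation
after multiplication by a suitable nonzero element of `K`. -/
theorem ValuationSubring.exists_forall_mul_mem {K F : Type*} [Field K] [Field F] [Algebra K F]
    [Algebra.IsAlgebraic K F] (W : ValuationSubring F) (D : Finset F) :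
    ∃ c : Kˣ, algebraMap K F c ∈ W ∧ ∀ d ∈ D, d * algebraMap K F c ∈ W := by
  classical
  induction D using Finset.induction_on with
  | empty => exact ⟨1, by simp [W.one_mem], by simp⟩
  | insert d D _ ih =>
    obtain ⟨c, hc, hD⟩ := ih
    let O := W.comap (algebraMap K F)
    have hd : IsAlgebraic O d :=
      (IsFractionRing.isAlgebraic_iff O K F).2 (Algebra.IsAlgebraic.isAlgebraic d)
    obtain ⟨y, hy, hint⟩ := hd.exists_integral_multiple
    have h1 : d * algebraMap K F y ∈ W := by
      let f : O →+* W := (algebraMap K F).restrict O W fun _ hx => hx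
      have h2 : IsIntegral W (y • d) := hint.map_of_comp_eq f (RingHom.id F) rfl
      obtain ⟨z, hz⟩ := IsIntegrallyClosed.isIntegral_iff.1 h2
      have h3 : y • d = d * algebraMap K F y := by
        rw [Algebra.smul_def, mul_comm]
        rfl
      rw [← h3, ← hz]
      exact z.2
    have hy0 : (y : K) ≠ 0 := fun h => hy (Subtype.ext h)
    refine ⟨c * Units.mk0 (y : K) hy0, ?_, ?_⟩
    · rw [Units.val_mul, map_mul]
      exact W.mul_mem _ _ hc y.2
    · intro e he
      rw [Units.val_mul, map_mul, Units.val_mk0]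
      rcases Finset.mem_insert.1 he with rfl | he
      · have := W.mul_mem _ _ hc h1
        convert this using 1
        ring
      · have := W.mul_mem _ _ (hD e he) y.2
        convert this using 1
        change _ = _ * _ * algebraMap K F y
        ring

namespace FieldValuationStructure

variable {K Ks X : Type*} [Field K] [Field Ks] [Algebra K Ks] [IsSepClosure K Ks]
  [TopologicalSpace X] [CompactSpace X] [T2Space X] [TotallyDisconnectedSpace X]
  [MulAction (Ks ≃ₐ[K] Ks) X] [ContinuousSMul (Ks ≃ₐ[K] Ks) X]
  (𝓚 : FieldValuationStructure K Ks X)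

/-- The valuation ring of `v_x`, as a subring of the separable closure. -/
def valRing (x : X) : Subring Ks := (𝓚.val x).toSubring.map (algebraMap (𝓚.field x) Ks)

variable {𝓚}

theorem mem_valRing_iff {x : X} {a : Ks} :
    a ∈ 𝓚.valRing x ↔ ∃ h : a ∈ 𝓚.field x, (⟨a, h⟩ : 𝓚.field x) ∈ 𝓚.val x := by
  constructor
  · rintro ⟨b, hb, rfl⟩
    exact ⟨b.2, hb⟩
  · rintro ⟨h, h'⟩
    exact ⟨⟨a, h⟩, h', rfl⟩

theorem isOpen_setOf_mem_valRing (a : Ks) : IsOpen {x | a ∈ 𝓚.valRing x} := by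
  have hint : IsIntegral K a := Algebra.IsIntegral.isIntegral a
  have hfin : FiniteDimensional K (IntermediateField.adjoin K {a}) :=
    IntermediateField.adjoin.finiteDimensional hint
  have h1 := 𝓚.isOpen_setOf_le (IntermediateField.adjoin K {a}) hfin
  have h2 := continuous_generateFrom_iff.1
    (𝓚.continuous_val (IntermediateField.adjoin K {a}) hfin) _
    ⟨IntermediateField.AdjoinSimple.gen K a, Or.inr rfl⟩
  convert h1.isOpenMap_subtype_val _ h2
  ext x
  simp only [Set.mem_ofPred_eq, mem_valRing_iff, Set.mem_image, Set.mem_preimage,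
    ValuationSubring.valuation_le_one_iff]
  constructor
  · rintro ⟨h, h'⟩
    exact ⟨⟨x, IntermediateField.adjoin_simple_le_iff.2 h⟩, h', rfl⟩
  · rintro ⟨⟨x, h⟩, h', rfl⟩
    exact ⟨IntermediateField.adjoin_simple_le_iff.1 h, h'⟩

variable (hH : 𝓚.IsHenselian)

/-- The unique extension of the Henselian valuation `v_x` to the separable closure. -/
def extVal (hH : 𝓚.IsHenselian) (x : X) : ValuationSubring Ks :=
  have := hH x
  have : Algebra.IsSeparable K Ks := IsSepClosure.separable
  henselianExtension (𝓚.val x)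

theorem mem_extVal_iff {x : X} {z : Ks} : z ∈ extVal hH x ↔ IsIntegral (𝓚.val x) z := Iff.rfl

theorem algebraMap_mem_extVal_iff {x : X} (a : 𝓚.field x) :
    algebraMap (𝓚.field x) Ks a ∈ extVal hH x ↔ a ∈ 𝓚.val x := by
  rw [mem_extVal_iff, isIntegral_algebraMap_iff (algebraMap (𝓚.field x) Ks).injective,
    IsIntegrallyClosed.isIntegral_iff]
  constructor
  · rintro ⟨z, rfl⟩
    exact z.2
  · exact fun h => ⟨⟨a, h⟩, rfl⟩

theorem map_mem_extVal_smul (σ : Ks ≃ₐ[K] Ks) {x : X} {z : Ks} (hz : z ∈ extVal hH x) :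
    σ z ∈ extVal hH (σ • x) := by
  have h1 : ∀ u : 𝓚.field x, σ u ∈ 𝓚.field (σ • x) := fun u => by
    rw [𝓚.field_smul]
    exact ⟨u, u.2, rfl⟩
  let f : 𝓚.field x →+* 𝓚.field (σ • x) :=
    ((σ : Ks →+* Ks).comp (algebraMap (𝓚.field x) Ks)).codRestrict _ h1
  let g : 𝓚.val x →+* 𝓚.val (σ • x) := f.restrict _ _ fun u hu =>
    (𝓚.val_smul σ x u u.2 (h1 u)).2 hu
  exact IsIntegral.map_of_comp_eq g (σ : Ks →+* Ks) rfl hz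

theorem map_mem_extVal_smul_iff (σ : Ks ≃ₐ[K] Ks) {x : X} {z : Ks} :
    σ z ∈ extVal hH (σ • x) ↔ z ∈ extVal hH x := by
  refine ⟨fun h => ?_, map_mem_extVal_smul hH σ⟩
  have := map_mem_extVal_smul hH σ⁻¹ h
  rw [inv_smul_smul] at this
  convert this
  exact (σ.symm_apply_apply z).symm

/-- Integrality of `z` is witnessed by finitely many coefficients, so it is an open condition. -/
theorem isOpen_setOf_mem_extVal (z : Ks) : IsOpen {x | z ∈ extVal hH x} := by
  refine isOpen_iff_mem_nhds.2 fun x hx => ?_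
  obtain ⟨P, hP, hz⟩ := (mem_extVal_iff hH).1 hx
  let Q : Polynomial Ks := P.map (algebraMap (𝓚.val x) Ks)
  have hQ : ∀ k, Q.coeff k ∈ 𝓚.valRing x := fun k => by
    rw [Polynomial.coeff_map]
    exact ⟨P.coeff k, (P.coeff k).2, rfl⟩
  have h1 : IsOpen (⋂ k ∈ Q.support, {y | Q.coeff k ∈ 𝓚.valRing y}) :=
    isOpen_biInter_finset fun k _ => isOpen_setOf_mem_valRing _
  refine Filter.mem_of_superset (h1.mem_nhds (Set.mem_iInter₂.2 fun k _ => hQ k)) fun y hy => ?_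
  have h2 : Q ∈ Polynomial.lifts (algebraMap (𝓚.val y) Ks) := by
    rw [Polynomial.lifts_iff_coeff_lifts]
    intro k
    by_cases hk : k ∈ Q.support
    · obtain ⟨a, ha, hak⟩ := Set.mem_iInter₂.1 hy k hk
      exact ⟨⟨a, ha⟩, hak⟩
    · rw [Polynomial.notMem_support_iff.1 hk]
      exact ⟨0, map_zero _⟩
  obtain ⟨P', hP', -, hmonic⟩ := Polynomial.lifts_and_degree_eq_and_monic h2 (hP.map _)
  refine (mem_extVal_iff hH).2 ⟨P', hmonic, ?_⟩
  rw [Polynomial.eval₂_eq_eval_map, hP', ← Polynomial.eval₂_eq_eval_map]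
  exact hz

theorem isClosed_setOf_valuation_lt_one (z : Ks) :
    IsClosed {x | (extVal hH x).valuation z < 1} := by
  rcases eq_or_ne z 0 with rfl | hz
  · simp
  rw [← isOpen_compl_iff]
  convert isOpen_setOf_mem_extVal hH z⁻¹
  ext x
  rw [Set.mem_compl_iff, Set.mem_ofPred_eq, Set.mem_ofPred_eq,
    ValuationSubring.valuation_lt_one_iff_inv_notMem _ hz, not_not]

theorem valuation_map_smul_lt_one_iff (σ : Ks ≃ₐ[K] Ks) {x : X} {z : Ks} :
    (extVal hH (σ • x)).valuation (σ z) < 1 ↔ (extVal hH x).valuation z < 1 := by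
  rcases eq_or_ne z 0 with rfl | hz
  · simp
  rw [ValuationSubring.valuation_lt_one_iff_inv_notMem _ hz,
    ValuationSubring.valuation_lt_one_iff_inv_notMem _ (by simpa using hz), ← map_inv₀,
    map_mem_extVal_smul_iff]

end FieldValuationStructure

/-! ### Special partitions of proper group structures -/

section ProfiniteAction

variable {G X : Type*} [Group G] [TopologicalSpace G] [CompactSpace G] [TopologicalSpace X]
  [MulAction G X] [ContinuousSMul G X]

/-- If an open subgroup `U` contains the stabilizer of `x`, then `x` has arbitrarily small clopen
neighbourhoods that are disjoint from their translates by elements outside `U`. -/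
theorem exists_isClopen_forall_smul_mem [CompactSpace X] [T2Space X]
    [TotallyDisconnectedSpace X] (x : X) (O : Set X) (hO : IsOpen O) (hx : x ∈ O)
    (U : Subgroup G) (hU : IsOpen (U : Set G)) (hxU : MulAction.stabilizer G x ≤ U) :
    ∃ C : Set X, IsClopen C ∧ x ∈ C ∧ C ⊆ O ∧ ∀ g : G, ∀ y ∈ C, g • y ∈ C → g ∈ U := by
  have hc : IsCompact ((U : Set G)ᶜ) := hU.isClosed_compl.isCompact
  have hE : IsCompact ((fun g : G => g • x) '' (U : Set G)ᶜ) :=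
    hc.image (continuous_id.smul continuous_const)
  have hxE : x ∉ (fun g : G => g • x) '' (U : Set G)ᶜ := by
    rintro ⟨g, hg, hgx⟩
    exact hg (hxU hgx)
  obtain ⟨W, V, hW, hV, hEW, hxV, hWV⟩ :=
    SeparatedNhds.of_isCompact_isCompact hE isCompact_singleton (Set.disjoint_singleton_right.2 hxE)
  have h1 : ∀ᶠ y in 𝓝 x, ∀ g ∈ (U : Set G)ᶜ, g • y ∈ W := by
    refine hc.eventually_forall_of_forall_eventually fun g hg => ?_
    have h2 : Continuous fun p : X × G => p.2 • p.1 := continuous_snd.smul continuous_fst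
    exact h2.continuousAt.eventually (hW.mem_nhds (hEW ⟨g, hg, rfl⟩))
  have h2 : ∀ᶠ y in 𝓝 x, y ∈ V := hV.mem_nhds (hxV rfl)
  obtain ⟨N, hN, hNo, hxN⟩ := mem_nhds_iff.1 (h1.and (h2.and (hO.mem_nhds hx)))
  obtain ⟨C, hC, hxC, hCN⟩ := compact_exists_isClopen_in_isOpen hNo hxN
  refine ⟨C, hC, hxC, fun y hy => (hN (hCN hy)).2.2, fun g y hy hgy => ?_⟩
  by_contra hg
  exact hWV.le_bot ⟨(hN (hCN hy)).1 g hg, (hN (hCN hgy)).2.1⟩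

/-- The coarsest `G`-invariant equivalence relation for which the given sets are unions of
classes. -/
def invariantSetoid (G : Type*) {X : Type*} [Group G] [MulAction G X] (𝒞 : Set (Set X)) :
    Setoid X where
  r y z := ∀ g : G, ∀ C ∈ 𝒞, (g • y ∈ C ↔ g • z ∈ C)
  iseqv := ⟨fun _ _ _ _ => Iff.rfl, fun h g C hC => (h g C hC).symm,
    fun h h' g C hC => (h g C hC).trans (h' g C hC)⟩

theorem isOpen_setOf_invariantSetoid {𝒞 : Set (Set X)} (hfin : 𝒞.Finite)
    (h𝒞 : ∀ C ∈ 𝒞, IsClopen C) (y : X) : IsOpen {z | (invariantSetoid G 𝒞).r y z} := by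
  have h1 : {z | (invariantSetoid G 𝒞).r y z} =
      ⋂ C ∈ 𝒞, {z | ∀ g : G, (g • y ∈ C ↔ g • z ∈ C)} := by
    ext z
    simp only [Set.mem_iInter, Set.mem_ofPred_eq]
    exact ⟨fun h C hC g => h g C hC, fun h g C hC => h C hC g⟩
  rw [h1]
  refine hfin.isOpen_biInter fun C hC => isOpen_iff_mem_nhds.2 fun z hz => ?_
  have h2 : ∀ᶠ z' in 𝓝 z, ∀ g ∈ (Set.univ : Set G), (g • z ∈ C ↔ g • z' ∈ C) := by
    refine isCompact_univ.eventually_forall_of_forall_eventually fun g _ => ?_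
    have h3 : Continuous fun p : X × G => p.2 • p.1 := continuous_snd.smul continuous_fst
    have h4 : Continuous fun p : X × G => p.2 • z := continuous_snd.smul continuous_const
    by_cases hg : g • z ∈ C
    · filter_upwards [h3.continuousAt.eventually ((h𝒞 C hC).isOpen.mem_nhds hg),
        h4.continuousAt.eventually ((h𝒞 C hC).isOpen.mem_nhds hg)] with p hp hp'
      exact ⟨fun _ => hp, fun _ => hp'⟩
    · have h5 := (h𝒞 C hC).compl.isOpen.mem_nhds hg
      filter_upwards [h3.continuousAt.eventually h5, h4.continuousAt.eventually h5] with p hp hp'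
      exact ⟨fun h => absurd h hp', fun h => absurd h hp⟩
  filter_upwards [h2] with z' hz' g
  exact (hz g).trans (hz' g trivial)

end ProfiniteAction

namespace GroupStructure

variable {G X : Type*}
  [Group G] [TopologicalSpace G] [IsTopologicalGroup G] [CompactSpace G]
  [TotallyDisconnectedSpace G]
  [TopologicalSpace X] [CompactSpace X] [T2Space X] [TotallyDisconnectedSpace X]
  [MulAction G X] [ContinuousSMul G X] {𝓖 : GroupStructure G X}

/-- In a proper group structure the subgroups `G_x` are the stabilizers. -/
theorem IsProper.sub_eq_stabilizer (h : 𝓖.IsProper) (x : X) :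
    (𝓖.sub x : Subgroup G) = MulAction.stabilizer G x := by
  refine le_antisymm (fun g hg => ?_) (𝓖.stabilizer_le x)
  refine (@Topology.IsEmbedding.injective _ _ _ (etaleTopology G) _ h) (SetLike.ext fun k => ?_)
  rw [𝓖.mem_sub_smul]
  have h1 : g ∈ (𝓖.sub x : Subgroup G) := hg
  change g⁻¹ * k * g ∈ (𝓖.sub x : Subgroup G) ↔ k ∈ (𝓖.sub x : Subgroup G)
  rw [Subgroup.mul_mem_cancel_right _ h1, Subgroup.mul_mem_cancel_left _ (inv_mem h1)]

/-- A proper group structure has arbitrarily fine special partitions: given a neighbourhood `O x` of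
each `x` and an open subgroup `U x` that contains `G_x`, there is one whose blocks are contained in
sets `O x` and whose groups are contained in the corresponding `U x`. -/
theorem IsProper.exists_isSpecialPartition (h : 𝓖.IsProper) (O : X → Set X)
    (hO : ∀ x, IsOpen (O x)) (hx : ∀ x, x ∈ O x) (U : X → Subgroup G)
    (hU : ∀ x, IsOpen (U x : Set G)) (hxU : ∀ x, (𝓖.sub x : Subgroup G) ≤ U x) :
    ∃ (n : ℕ) (x : Fin n → X) (B : Fin n → Set X),
      𝓖.IsSpecialPartition (fun i => MulAction.stabilizer G (B i)) B ∧
      (∀ i, B i ⊆ O (x i)) ∧ (∀ i, MulAction.stabilizer G (B i) ≤ U (x i)) ∧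
      (∀ y, ∃ i, ∃ ρ : G, y ∈ ρ • B i) ∧
      ∀ i j, ∀ g : G, (g • B i ∩ B j).Nonempty → i = j ∧ g ∈ MulAction.stabilizer G (B i) := by
  classical
  choose C hC hxC hCO hCU using fun x => exists_isClopen_forall_smul_mem x (O x) (hO x) (hx x)
    (U x) (hU x) (by
      rw [← h.sub_eq_stabilizer]
      exact hxU x)
  obtain ⟨T, hT⟩ := isCompact_univ.elim_finite_subcover C (fun x => (hC x).isOpen)
    fun x _ => Set.mem_iUnion.2 ⟨x, hxC x⟩
  let 𝒞 : Set (Set X) := C '' T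
  have h𝒞fin : 𝒞.Finite := T.finite_toSet.image C
  have h𝒞 : ∀ D ∈ 𝒞, IsClopen D := by
    rintro _ ⟨x, _, rfl⟩
    exact hC x
  let r := invariantSetoid G 𝒞
  let Q := Quotient r
  let mk : X → Q := Quotient.mk r
  have hmk : ∀ y z, mk y = mk z ↔ ∀ g : G, ∀ D ∈ 𝒞, (g • y ∈ D ↔ g • z ∈ D) :=
    fun y z => Quotient.eq (r := r)
  have hopen : ∀ y, IsOpen {z | mk z = mk y} := fun y => by
    convert isOpen_setOf_invariantSetoid (G := G) h𝒞fin h𝒞 y using 1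
    ext z
    exact eq_comm.trans (hmk y z)
  have hsmul : ∀ (g : G) (y z : X), mk y = mk z → mk (g • y) = mk (g • z) := by
    intro g y z hyz
    rw [hmk] at hyz ⊢
    intro k D hD
    rw [smul_smul, smul_smul]
    exact hyz _ D hD
  have hsmul' : ∀ (g : G) (y z : X), mk (g • y) = mk (g • z) ↔ mk y = mk z := fun g y z =>
    ⟨fun h => by simpa using hsmul g⁻¹ _ _ h, hsmul g y z⟩
  have hfin : Finite Q := by
    obtain ⟨T', hT'⟩ := isCompact_univ.elim_finite_subcover (fun y => {z | mk z = mk y})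
      hopen fun x _ => Set.mem_iUnion.2 ⟨x, rfl⟩
    refine Finite.of_surjective (fun y : T' => mk y) fun q => ?_
    obtain ⟨z, rfl⟩ := Quotient.exists_rep q
    obtain ⟨y, hy, hzy⟩ := Set.mem_iUnion₂.1 (hT' (Set.mem_univ z))
    exact ⟨⟨y, hy⟩, Eq.symm hzy⟩
  -- Two points lie in the same orbit of classes if a translate of one is equivalent to the other.
  let orb : Setoid X :=
    { r := fun y z => ∃ g : G, mk (g • y) = mk z
      iseqv := ⟨fun y => ⟨1, by rw [one_smul]⟩,
        fun {y z} ⟨g, hg⟩ => ⟨g⁻¹, by rw [← hsmul' g, smul_inv_smul, hg]⟩,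
        fun {y z w} ⟨g, hg⟩ ⟨k, hk⟩ => ⟨k * g, by rw [mul_smul, ← hk, hsmul', hg]⟩⟩ }
  have horb : Finite (Quotient orb) := by
    refine Finite.of_surjective (fun q : Q => Quotient.mk orb q.out) fun o => ?_
    obtain ⟨z, rfl⟩ := Quotient.exists_rep o
    refine ⟨mk z, Quotient.sound ⟨1, ?_⟩⟩
    rw [one_smul]
    exact Quotient.out_eq (mk z)
  obtain ⟨n, ⟨e⟩⟩ := Finite.exists_equiv_fin (Quotient orb)
  let y : Fin n → X := fun i => (e.symm i).out
  have hy : ∀ z, ∃ i, ∃ g : G, mk (g • y i) = mk z := fun z => by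
    refine ⟨e (Quotient.mk orb z), ?_⟩
    have : orb.r (Quotient.out (Quotient.mk orb z)) z := Quotient.exact (Quotient.out_eq _)
    simp only [y, Equiv.symm_apply_apply]
    exact this
  have hyinj : ∀ i j, ∀ g : G, mk (g • y i) = mk (y j) → i = j := by
    intro i j g hg
    have h1 : Quotient.mk orb (y i) = Quotient.mk orb (y j) := Quotient.sound ⟨g, hg⟩
    simp only [y, Quotient.out_eq] at h1
    exact e.symm.injective h1
  choose x hxT hyx using fun i => Set.mem_iUnion₂.1 (hT (Set.mem_univ (y i)))
  let B : Fin n → Set X := fun i => {z | mk z = mk (y i)}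
  have hB : ∀ i z (g : G), z ∈ g • B i ↔ mk z = mk (g • y i) := fun i z g => by
    rw [Set.mem_smul_set_iff_inv_smul_mem]
    change mk (g⁻¹ • z) = mk (y i) ↔ _
    rw [← hsmul' g, smul_inv_smul]
  have hstab : ∀ i (g : G), g ∈ MulAction.stabilizer G (B i) ↔ mk (g • y i) = mk (y i) := by
    intro i g
    rw [MulAction.mem_stabilizer_iff]
    constructor
    · intro hg
      have : g • y i ∈ g • B i := Set.smul_mem_smul_set rfl
      rwa [hg] at this
    · intro hg
      ext z
      rw [hB, hg]
      rfl
  have hBC : ∀ i, B i ⊆ C (x i) := by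
    intro i z hz
    have := (hmk z (y i)).1 hz 1 (C (x i)) ⟨x i, hxT i, rfl⟩
    rw [one_smul, one_smul] at this
    exact this.2 (hyx i)
  have hmeet : ∀ i j, ∀ g : G, (g • B i ∩ B j).Nonempty →
      i = j ∧ g ∈ MulAction.stabilizer G (B i) := by
    rintro i j g ⟨z, hz, hz'⟩
    rw [hB] at hz
    have h1 : mk (g • y i) = mk (y j) := hz.symm.trans hz'
    obtain rfl := hyinj i j g h1
    exact ⟨rfl, (hstab i g).2 h1⟩
  have hopenS : ∀ i, IsOpen (MulAction.stabilizer G (B i) : Set G) := by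
    intro i
    have : Continuous fun g : G => g • y i := continuous_id.smul continuous_const
    convert (hopen (y i)).preimage this
    ext g
    exact hstab i g
  refine ⟨n, x, B, ⟨fun i => ⟨?_, hopen _⟩, hopenS, fun i z hz g hg => ?_, fun i => rfl, ?_⟩,
    fun i => (hBC i).trans (hCO _), fun i g hg => ?_, fun z => ?_, hmeet⟩
  · rw [← isOpen_compl_iff, isOpen_iff_mem_nhds]
    intro z hz
    refine Filter.mem_of_superset ((hopen z).mem_nhds rfl) fun z' hz' hz'' => hz ?_
    exact hz'.symm.trans hz''
  · rw [h.sub_eq_stabilizer, MulAction.mem_stabilizer_iff] at hg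
    refine (hmeet i i g ⟨z, ?_, hz⟩).2
    rw [hB, ← hg, hsmul']
    exact hz
  -- The transversals: for each class in the orbit of the class of `y i`, one element that moves the
  -- latter to the former.
  · choose t ht using fun (i : Fin n) (q : Q) => (em (∃ g : G, mk (g • y i) = q)).elim
      (fun h => ⟨h.choose, fun _ => h.choose_spec⟩)
      (fun h => ⟨(1 : G), fun h' => absurd h' h⟩ :
        ¬ (∃ g : G, mk (g • y i) = q) → ∃ g : G, (∃ g : G, mk (g • y i) = q) → mk (g • y i) = q)
    cases nonempty_fintype Q
    let R : Fin n → Finset G := fun i =>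
      (Finset.univ.filter fun q => ∃ g : G, mk (g • y i) = q).image (t i)
    have hR : ∀ i (g : G), t i (mk (g • y i)) ∈ R i := fun i g =>
      Finset.mem_image.2 ⟨_, Finset.mem_filter.2 ⟨Finset.mem_univ _, g, rfl⟩, rfl⟩
    have hR' : ∀ i, ∀ ρ ∈ R i, t i (mk (ρ • y i)) = ρ := by
      intro i ρ hρ
      obtain ⟨q, hq, rfl⟩ := Finset.mem_image.1 hρ
      rw [ht i q (Finset.mem_filter.1 hq).2]
    have hmemS : ∀ i (ρ g : G), g ∈ ρ • (MulAction.stabilizer G (B i) : Set G) ↔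
        mk (g • y i) = mk (ρ • y i) := by
      intro i ρ g
      rw [Set.mem_smul_set_iff_inv_smul_mem, SetLike.mem_coe, hstab, ← hsmul' ρ, smul_eq_mul,
        smul_smul, mul_inv_cancel_left]
    refine ⟨R, fun i => ⟨?_, ?_⟩, ?_, ?_⟩
    · refine Set.eq_univ_of_forall fun g => Set.mem_iUnion₂.2 ⟨_, hR i g, ?_⟩
      rw [hmemS, ht i _ ⟨g, rfl⟩]
    · intro ρ hρ ρ' hρ' hne
      refine Set.disjoint_left.2 fun g hg hg' => hne ?_
      rw [hmemS] at hg hg'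
      rw [← hR' i ρ hρ, ← hR' i ρ' hρ', ← hg, hg']
    · refine Set.eq_univ_of_forall fun z => ?_
      obtain ⟨i, g, hg⟩ := hy z
      refine Set.mem_iUnion.2 ⟨i, Set.mem_iUnion₂.2 ⟨_, hR i g, ?_⟩⟩
      rw [hB, ht i _ ⟨g, rfl⟩, hg]
    · rintro ⟨i, ρ⟩ hρ ⟨j, ρ'⟩ hρ' hne
      refine Set.disjoint_left.2 fun z hz hz' => hne ?_
      dsimp only at hz hz'
      rw [hB] at hz hz'
      have h1 : mk (ρ • y i) = mk (ρ' • y j) := hz.symm.trans hz'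
      obtain rfl := hyinj i j (ρ'⁻¹ * ρ) (by
        rw [← hsmul' ρ', smul_smul, mul_inv_cancel_left, h1])
      have h2 : ρ = ρ' := by rw [← hR' i ρ hρ, ← hR' i ρ' hρ', h1]
      rw [h2]
  · refine hCU (x i) g (y i) (hyx i) (hBC i ?_)
    exact (hstab i g).1 hg
  · obtain ⟨i, g, hg⟩ := hy z
    exact ⟨i, g, (hB i z g).2 hg.symm⟩

end GroupStructure

/-! ### Gluing local solutions -/

namespace GroupStructure

variable {G X A I B J : Type*}
  [Group G] [TopologicalSpace G] [IsTopologicalGroup G] [CompactSpace G]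
  [TotallyDisconnectedSpace G]
  [TopologicalSpace X] [CompactSpace X] [T2Space X] [TotallyDisconnectedSpace X]
  [MulAction G X] [ContinuousSMul G X]
  [Group A] [Finite A] [TopologicalSpace A] [DiscreteTopology A]
  [Finite I] [TopologicalSpace I] [DiscreteTopology I] [MulAction A I] [ContinuousSMul A I]
  [Group B] [Finite B] [TopologicalSpace B] [DiscreteTopology B]
  [Finite J] [TopologicalSpace J] [DiscreteTopology J] [MulAction B J] [ContinuousSMul B J]
  {𝓖 : GroupStructure G X} {𝓐 : GroupStructure A I} {𝓑 : GroupStructure B J}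

omit [TopologicalSpace G] [IsTopologicalGroup G] [CompactSpace G] [TotallyDisconnectedSpace G] in
/-- Along a cover `α`, a homomorphism to `A` lifts over the preimage of each group `A_i`. -/
theorem Hom.IsCover.exists_local_lift {α : Hom 𝓑 𝓐} (hα : α.IsCover) (φ : G →* A) (j : J) :
    ∃ γ : Subgroup.comap φ (𝓐.sub (α.onSpace j) : Subgroup A) →* B,
      (∀ σ, γ σ ∈ 𝓑.sub j) ∧ ∀ σ, α.onGroup (γ σ) = φ σ := by
  have hbij := hα.bijOn j
  choose γ hγ hγφ using fun σ : Subgroup.comap φ (𝓐.sub (α.onSpace j) : Subgroup A) =>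
    hbij.surjOn σ.2
  refine ⟨MonoidHom.mk' γ fun σ τ => hbij.injOn (hγ _) (mul_mem (hγ σ) (hγ τ)) ?_, hγ, hγφ⟩
  rw [hγφ, map_mul, hγφ, hγφ, Subgroup.coe_mul, map_mul]

/-- Local solutions of an embedding problem on the blocks of a special partition, conjugated by
locally constant functions `b i` with values in the kernel of `α`, glue to a global solution. -/
theorem exists_hom_of_blocks {φ : Hom 𝓖 𝓐} {α : Hom 𝓑 𝓐} (hα : α.IsCover)
    (hstab : ∀ x, (𝓖.sub x : Subgroup G) = MulAction.stabilizer G x)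
    (γ : G →ₜ* B) (hγ : ∀ g, α.onGroup (γ g) = φ.onGroup g)
    {ι : Type*} (P : ι → Set X) (hP : ∀ i, IsOpen (P i)) (hcov : ∀ y, ∃ i, ∃ ρ : G, y ∈ ρ • P i)
    (hmeet : ∀ i j, ∀ g : G, (g • P i ∩ P j).Nonempty →
      i = j ∧ g ∈ MulAction.stabilizer G (P i))
    (j : ι → J) (hj : ∀ i, ∀ z ∈ P i, φ.onSpace z = α.onSpace (j i))
    (γ₀ : ι → G → B) (hγ₀ : ∀ i, ∀ g ∈ MulAction.stabilizer G (P i), γ₀ i g ∈ 𝓑.sub (j i))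
    (hγ₀φ : ∀ i, ∀ g ∈ MulAction.stabilizer G (P i), α.onGroup (γ₀ i g) = φ.onGroup g)
    (b : ι → X → B) (hb : ∀ i, ∀ z ∈ P i, α.onGroup (b i z) = 1)
    (hbγ : ∀ i, ∀ z ∈ P i, ∀ g ∈ MulAction.stabilizer G (P i),
      b i (g • z) = γ g * b i z * (γ₀ i g)⁻¹)
    (hbloc : ∀ i, ∀ z ∈ P i, ∀ᶠ z' in 𝓝 z, b i z' = b i z) :
    ∃ Γ : Hom 𝓖 𝓑, α.comp Γ = φ := by
  have hmemP : ∀ i, ∀ z ∈ P i, ∀ g ∈ MulAction.stabilizer G (P i), g • z ∈ P i := by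
    intro i z hz g hg
    rw [MulAction.mem_stabilizer_iff] at hg
    rw [← hg]
    exact Set.smul_mem_smul_set hz
  -- The local solutions fix the chosen points `j i`, since the kernel of `α` meets `B_{j i}`
  -- trivially.
  have hfix : ∀ i, ∀ z ∈ P i, ∀ g ∈ MulAction.stabilizer G (P i), γ₀ i g • j i = j i := by
    intro i z hz g hg
    have h1 : α.onSpace (γ₀ i g • j i) = α.onSpace (j i) := by
      rw [α.map_smul, hγ₀φ i g hg, ← hj i z hz, ← φ.map_smul, hj i _ (hmemP i z hz g hg),
        hj i z hz]
    obtain ⟨k, hk, hkj⟩ := hα.exists_smul_eq _ _ h1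
    have h2 : k * γ₀ i g ∈ (𝓑.sub (j i) : Subgroup B) := 𝓑.stabilizer_le _ (by
      rw [MulAction.mem_stabilizer_iff, mul_smul, hkj])
    have h3 : k ∈ (𝓑.sub (j i) : Subgroup B) :=
      (Subgroup.mul_mem_cancel_right _ (hγ₀ i g hg)).1 h2
    have h4 : k = 1 := (hα.bijOn (j i)).injOn h3 (one_mem _) (by rw [hk, map_one])
    rwa [h4, one_smul] at hkj
  have hstep : ∀ i, ∀ z ∈ P i, ∀ g ∈ MulAction.stabilizer G (P i),
      b i (g • z) • j i = γ g • b i z • j i := by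
    intro i z hz g hg
    rw [hbγ i z hz g hg, mul_smul, mul_smul, inv_smul_eq_iff.2 (hfix i z hz g hg).symm]
  choose i ρ hρ using hcov
  let Γ : X → J := fun y => γ (ρ y) • b (i y) ((ρ y)⁻¹ • y) • j (i y)
  have hρ' : ∀ y, (ρ y)⁻¹ • y ∈ P (i y) := fun y => Set.mem_smul_set_iff_inv_smul_mem.1 (hρ y)
  have hΓ : ∀ k, ∀ z ∈ P k, ∀ g : G, Γ (g • z) = γ g • b k z • j k := by
    intro k z hz g
    have h1 := hρ' (g • z)
    rw [smul_smul] at h1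
    obtain ⟨rfl, hg⟩ := hmeet k (i (g • z)) _ ⟨_, Set.smul_mem_smul_set hz, h1⟩
    have h2 := hstep _ z hz _ hg
    simp only [Γ]
    rw [smul_smul (ρ (g • z))⁻¹ g z, h2, smul_smul, ← map_mul, mul_inv_cancel_left]
  have hrep : ∀ y, ∃ k, ∃ z ∈ P k, ∃ g : G, y = g • z := fun y =>
    ⟨i y, _, hρ' y, ρ y, (smul_inv_smul _ _).symm⟩
  refine ⟨⟨γ, ⟨Γ, ?_⟩, ?_, ?_⟩, ?_⟩
  · refine continuous_iff_continuousAt.2 fun y => ?_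
    obtain ⟨k, z, hz, g, rfl⟩ := hrep y
    rw [ContinuousAt, nhds_discrete J, Filter.tendsto_pure]
    have h1 : Filter.Tendsto (fun y' => g⁻¹ • y') (𝓝 (g • z)) (𝓝 z) := by
      have : Continuous fun y' : X => g⁻¹ • y' := continuous_const_smul _
      convert this.tendsto (g • z)
      rw [inv_smul_smul]
    filter_upwards [h1.eventually (hbloc k z hz), h1.eventually ((hP k).mem_nhds hz)]
      with y' h2 h3
    have h4 := hΓ k _ h3 g
    rw [smul_inv_smul] at h4
    rw [h4, h2, hΓ k z hz]
  · intro g y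
    obtain ⟨k, z, hz, h, rfl⟩ := hrep y
    change Γ (g • h • z) = γ g • Γ (h • z)
    rw [smul_smul, hΓ k z hz, hΓ k z hz, map_mul, mul_smul]
  · intro y σ hσ
    obtain ⟨k, z, hz, g, rfl⟩ := hrep y
    change γ σ ∈ 𝓑.sub (Γ (g • z))
    rw [𝓖.mem_sub_smul] at hσ
    set τ := g⁻¹ * σ * g with hτ
    have hτz : τ • z = z := by
      have : τ ∈ (𝓖.sub z : Subgroup G) := hσ
      rwa [hstab] at this
    have hτS : τ ∈ MulAction.stabilizer G (P k) :=
      (hmeet k k τ ⟨z, by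
        rw [← hτz]
        exact Set.smul_mem_smul_set hz, hz⟩).2
    have h1 := hbγ k z hz τ hτS
    rw [hτz, eq_mul_inv_iff_mul_eq] at h1
    rw [hΓ k z hz, 𝓑.mem_sub_smul, 𝓑.mem_sub_smul]
    have h2 : (b k z)⁻¹ * ((γ g)⁻¹ * γ σ * γ g) * b k z = γ₀ k τ := by
      have h3 : (γ g)⁻¹ * γ σ * γ g = γ τ := by rw [hτ, map_mul, map_mul, map_inv]
      rw [h3, mul_assoc, ← h1, inv_mul_cancel_left]
    rw [h2]
    exact hγ₀ k τ hτS
  · refine Hom.ext (ContinuousMonoidHom.ext hγ) (ContinuousMap.ext fun y => ?_)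
    obtain ⟨k, z, hz, g, rfl⟩ := hrep y
    change α.onSpace (Γ (g • z)) = _
    rw [hΓ k z hz, α.map_smul, α.map_smul, hγ, hb k z hz, one_smul, φ.map_smul, hj k z hz]

end GroupStructure

/-- A finite quotient `φ` of the Galois group is realized by a finite Galois extension `L`, and
every homomorphism with the same image as `φ` induces an epimorphism to `Gal(L / K)`. -/
theorem exists_isGalois_of_isOpen_ker {K Ks A B : Type*} [Field K] [Field Ks] [Algebra K Ks]
    [IsGalois K Ks] [Group A] [Group B] (φ : Gal(Ks/K) →* A)
    (hφ : IsOpen (φ.ker : Set Gal(Ks/K))) (α : B →* A) (hα : α.range = φ.range) :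
    ∃ (L : IntermediateField K Ks) (_ : FiniteDimensional K L) (_ : IsGalois K L)
      (π : B →* Gal(L/K)), Function.Surjective π ∧
      ∀ b σ, (∀ l, (π b l : Ks) = σ l) ↔ α b = φ σ := by
  let L : IntermediateField K Ks := IntermediateField.fixedField φ.ker
  have hL : L.fixingSubgroup = φ.ker :=
    InfiniteGalois.fixingSubgroup_fixedField ⟨φ.ker, Subgroup.isClosed_of_isOpen _ hφ⟩
  have hfin : FiniteDimensional K L := by
    rw [← InfiniteGalois.isOpen_iff_finite, hL]
    exact hφ
  have hgal : IsGalois K L := by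
    rw [← InfiniteGalois.normal_iff_isGalois, hL]
    infer_instance
  let r := AlgEquiv.restrictNormalHom (F := K) (K₁ := Ks) L
  have hr : Function.Surjective r := AlgEquiv.restrictNormalHom_surjective Ks
  have hker : r.ker = φ.ker := by rw [IntermediateField.restrictNormalHom_ker, hL]
  have hrφ : ∀ σ τ, r σ = r τ ↔ φ σ = φ τ := fun σ τ => by
    rw [← inv_mul_eq_one, ← map_inv, ← map_mul, ← MonoidHom.mem_ker, hker, MonoidHom.mem_ker,
      map_mul, map_inv, inv_mul_eq_one]
  have hex : ∀ b, ∃ σ, φ σ = α b := fun b => by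
    have : α b ∈ φ.range := hα ▸ ⟨b, rfl⟩
    exact this
  choose t ht using hex
  let π : B →* Gal(L/K) := MonoidHom.mk' (fun b => r (t b)) fun b c => by
    rw [← map_mul, hrφ, map_mul, ht, ht, ht, map_mul]
  refine ⟨L, hfin, hgal, π, fun ρ => ?_, fun b σ => ?_⟩
  · obtain ⟨σ, rfl⟩ := hr ρ
    have : φ σ ∈ α.range := hα ▸ ⟨σ, rfl⟩
    obtain ⟨b, hb⟩ := this
    exact ⟨b, (hrφ _ _).2 (by rw [ht, hb])⟩
  · rw [← ht b, ← hrφ]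
    have h1 : ∀ l : L, (r σ l : Ks) = σ l := fun l => AlgEquiv.restrictNormal_commutes σ L l
    constructor
    · intro h
      ext l
      rw [h1, ← h]
      rfl
    · intro h l
      rw [← h1, ← h]
      rfl

/-! ### Projectivity -/

namespace FieldValuationStructure

variable {K Ks X : Type*} [Field K] [Field Ks] [Algebra K Ks] [IsSepClosure K Ks]
  [TopologicalSpace X] [CompactSpace X] [T2Space X] [TotallyDisconnectedSpace X]
  [MulAction (Ks ≃ₐ[K] Ks) X] [ContinuousSMul (Ks ≃ₐ[K] Ks) X]
  {𝓚 : FieldValuationStructure K Ks X}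

/-- The block approximation condition, phrased for the spectrum of a smooth geometrically integral
algebra `S` with generators `s`, and for the extensions of the `v_x` to the separable closure. -/
theorem BlockApproximationCondition.exists_algHom (hblock : 𝓚.BlockApproximationCondition)
    (hH : 𝓚.IsHenselian) {S : Type*} [CommRing S] [Algebra K S] [Algebra.Smooth K S]
    (hS : IsDomain (AlgebraicClosure K ⊗[K] S)) {n : ℕ} (s : Fin n → S)
    (hs : Function.Surjective (MvPolynomial.aeval (R := K) s)) {ι : Type} [Finite ι]
    (P : ι → Set X)
    (hP : 𝓚.gal.IsSpecialPartition (fun i => MulAction.stabilizer (Ks ≃ₐ[K] Ks) (P i)) P)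
    (q : ι → S →ₐ[K] Ks)
    (hq : ∀ i, ∀ σ ∈ MulAction.stabilizer (Ks ≃ₐ[K] Ks) (P i), ∀ x, σ (q i x) = q i x)
    (c : ι → Kˣ) :
    ∃ ψ : S →ₐ[K] K, ∀ i, ∀ x ∈ P i, ∀ k,
      (extVal hH x).valuation (algebraMap K Ks (ψ (s k)) - q i (s k)) <
        (extVal hH x).valuation (algebraMap K Ks (c i)) := by
  have : Algebra.IsSeparable K Ks := IsSepClosure.separable
  let L : ι → IntermediateField K Ks := fun i =>
    IntermediateField.fixedField (MulAction.stabilizer (Ks ≃ₐ[K] Ks) (P i))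
  have hL : ∀ i, (L i).fixingSubgroup = MulAction.stabilizer (Ks ≃ₐ[K] Ks) (P i) := fun i =>
    InfiniteGalois.fixingSubgroup_fixedField
      ⟨MulAction.stabilizer (Ks ≃ₐ[K] Ks) (P i), Subgroup.isClosed_of_isOpen _ (hP.isOpen i)⟩
  have hqL : ∀ i x, q i x ∈ L i := fun i x σ => hq i σ σ.2 x
  let q' : ∀ i, S →ₐ[K] L i := fun i => (q i).codRestrict (L i).toSubalgebra (hqL i)
  let Q : 𝓚.BlockApproximationProblem ι :=
    { n := n
      V := RingHom.ker (MvPolynomial.aeval (R := K) s)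
      block := P
      L := L
      point := fun i k => q' i (s k)
      c := c
      finite_L := fun i => by
        rw [← InfiniteGalois.isOpen_iff_finite, hL]
        exact hP.isOpen i
      isSpecialPartition := by
        simp only [hL]
        exact hP
      isVariety := isSmoothAbsIrredVariety_ker_aeval hS s hs
      isRationalPoint := fun i => isRationalPoint_ker_aeval s (q' i) fun k => rfl }
  obtain ⟨a, ha, hsol⟩ := hblock ι Q
  obtain ⟨ψ, hψ⟩ := exists_algHom_of_isRationalPoint s hs ha
  refine ⟨ψ, fun i x hx k => ?_⟩
  have h1 := (ValuationSubring.valuation_lt_iff_of_comap (algebraMap_mem_extVal_iff hH)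
    _ _).2 (hsol i x hx k)
  rw [map_sub] at h1
  rw [hψ]
  exact h1

open NormalBasisAlgebra in
/-- The arithmetic part of the proof of projectivity. Let `γ₀ x`, defined on an open subgroup that
contains `G_x`, be local solutions of an embedding problem for the Galois group. By block approximation
there are a global solution `γ`, a special partition, and locally constant functions `b i` to the kernel
of `α` that satisfy on the blocks the cocycle relation by which they conjugate `γ` to the local
solutions. -/
theorem exists_global_hom (hproper : 𝓚.IsProper) (hH : 𝓚.IsHenselian)
    (hblock : 𝓚.BlockApproximationCondition) {A B : Type*} [Group A] [Group B] [Finite B]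
    (φ : Gal(Ks/K) →* A) (hφ : IsOpen (φ.ker : Set Gal(Ks/K))) (α : B →* A)
    (hα : α.range = φ.range) (O : X → Set X) (hO : ∀ x, IsOpen (O x)) (hx : ∀ x, x ∈ O x)
    (U : X → Subgroup Gal(Ks/K)) (hU : ∀ x, (𝓚.gal.sub x : Subgroup Gal(Ks/K)) ≤ U x)
    (γ₀ : ∀ x, U x →* B) (hγ₀ : ∀ x, ∀ σ : U x, α (γ₀ x σ) = φ σ)
    (hγ₀ker : ∀ x, IsOpen (((γ₀ x).ker.map (U x).subtype : Subgroup Gal(Ks/K)) :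
      Set Gal(Ks/K))) :
    ∃ γ : Gal(Ks/K) →* B, IsOpen (γ.ker : Set Gal(Ks/K)) ∧ (∀ σ, α (γ σ) = φ σ) ∧
      ∃ (m : ℕ) (x : Fin m → X) (P : Fin m → Set X),
        (∀ i, IsOpen (P i)) ∧ (∀ i, P i ⊆ O (x i)) ∧
        (∀ y, ∃ i, ∃ ρ : Gal(Ks/K), y ∈ ρ • P i) ∧
        (∀ i j, ∀ g : Gal(Ks/K), (g • P i ∩ P j).Nonempty →
          i = j ∧ g ∈ MulAction.stabilizer Gal(Ks/K) (P i)) ∧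
        ∃ hPU : ∀ i, MulAction.stabilizer Gal(Ks/K) (P i) ≤ U (x i),
        ∃ b : Fin m → X → B,
          (∀ i, ∀ z ∈ P i, α (b i z) = 1) ∧
          (∀ i, ∀ z ∈ P i, ∀ (g : Gal(Ks/K)) (hg : g ∈ MulAction.stabilizer Gal(Ks/K) (P i)),
            b i (g • z) = γ g * b i z * (γ₀ (x i) ⟨g, hPU i hg⟩)⁻¹) ∧
          ∀ i, ∀ z ∈ P i, ∀ᶠ z' in 𝓝 z, b i z' = b i z := by
  classical
  cases nonempty_fintype B
  have : Algebra.IsSeparable K Ks := IsSepClosure.separable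
  obtain ⟨L, _, _, π, hπ, hπφ⟩ := exists_isGalois_of_isOpen_ker φ hφ α hα
  have hαπ : ∀ b, π b = 1 ↔ α b = 1 := fun b => by
    rw [← map_one φ, ← hπφ]
    constructor
    · intro h l
      rw [h]
      rfl
    · intro h
      ext l
      exact h l
  -- The torsor, and its ring of invariants `S`.
  let R := TorsorRing π
  let S := FixedPoints.subalgebra K R B
  obtain ⟨u, hu⟩ := TorsorRing.exists_isDualFamily π
  have : Algebra.Smooth K R := TorsorRing.smooth π
  have : Algebra.Smooth K S := NormalBasisAlgebra.smooth hu
  have hS : IsDomain (AlgebraicClosure K ⊗[K] S) :=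
    TorsorRing.isDomain_tensorProduct_fixedPoints hπ _
  obtain ⟨n, s, hs⟩ : ∃ (n : ℕ) (s : Fin n → S),
      Function.Surjective (MvPolynomial.aeval (R := K) s) := by
    obtain ⟨n, f, hf⟩ := (Algebra.FiniteType.iff_quotient_mvPolynomial'' (R := K) (S := S)).1
      inferInstance
    refine ⟨n, fun k => f (MvPolynomial.X k), ?_⟩
    have : MvPolynomial.aeval (fun k => f (MvPolynomial.X k)) = f :=
      MvPolynomial.algHom_ext fun k => by simp
    rwa [this]
  have hs' : Algebra.adjoin K (Set.range s) = ⊤ := by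
    rw [Algebra.adjoin_range_eq_range_aeval, AlgHom.range_eq_top]
    exact hs
  -- The points of the torsor that correspond to the local solutions.
  choose p₀ hp₀ using fun x => TorsorRing.exists_point_of_hom (π := π) (U x) (γ₀ x) (hγ₀ker x)
    fun σ l => (hπφ _ _).2 (hγ₀ x σ) l
  choose D hD using fun x =>
    exists_finset_existsUnique_comparison hπ TorsorRing.smul_algebraMap hu s hs' (p₀ x)
  choose c _ hc using fun x => (extVal hH x).exists_forall_mul_mem (K := K) (D x)
  let N : X → Set X := fun x => ⋂ d ∈ D x, {y | d * algebraMap K Ks (c x) ∈ extVal hH y}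
  have hN : ∀ x, IsOpen (N x) := fun x =>
    isOpen_biInter_finset fun d _ => isOpen_setOf_mem_extVal hH _
  have hUopen : ∀ x, IsOpen (U x : Set Gal(Ks/K)) := fun x => Subgroup.isOpen_mono (by
    rintro _ ⟨σ, _, rfl⟩
    exact σ.2) (hγ₀ker x)
  obtain ⟨m, x, P, hP, hPO, hPU, hcov, hmeet⟩ :=
    GroupStructure.IsProper.exists_isSpecialPartition hproper (fun x => O x ∩ N x)
      (fun x => (hO x).inter (hN x)) (fun x => ⟨hx x, Set.mem_iInter₂.2 (hc x)⟩) U hUopen hU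
  obtain ⟨ψ, hψ⟩ := hblock.exists_algHom hH hS s hs P hP
    (fun i => ((p₀ (x i)).restrictScalars K).comp S.val)
    (fun i σ hσ r => by
      change σ (p₀ (x i) r) = p₀ (x i) r
      rw [hp₀ (x i) ⟨σ, hPU i hσ⟩ r]
      exact congrArg _ (r.2 _)) fun i => c (x i)
  obtain ⟨p, γ, hpψ, hpγ, hγker⟩ := TorsorRing.exists_point_of_rational (Ks := Ks) hπ ψ
  have hγφ : ∀ σ, α (γ σ) = φ σ := fun σ => (hπφ _ _).1 fun l => by
    have := hpγ σ (algebraMap L R l)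
    rw [TorsorRing.smul_algebraMap, AlgHom.commutes, AlgHom.commutes] at this
    exact this.symm
  -- By Krasner's lemma, each point of a block determines an element of the kernel of `π`.
  let Θ : Fin m → B → Ks := fun i => comparison (TorsorRing.X π 1) u (p₀ (x i)) p
  have huniq : ∀ i, ∀ z ∈ P i, ∃! k : π.ker, (extVal hH z).valuation (Θ i k - 1) < 1 :=
    fun i z hz => hD (x i) (extVal hH z) (algebraMap K Ks (c (x i)))
      (fun d hd => Set.mem_iInter₂.1 (hPO i hz).2 d hd) p fun k => by
        have := hψ i z hz k
        rw [← hpψ] at this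
        exact this
  have hex : ∀ i z, ∃ k : π.ker, z ∈ P i → (extVal hH z).valuation (Θ i k - 1) < 1 := by
    intro i z
    by_cases hz : z ∈ P i
    · obtain ⟨k, hk, -⟩ := huniq i z hz
      exact ⟨k, fun _ => hk⟩
    · exact ⟨1, fun h => absurd h hz⟩
  choose b hb using hex
  have hb' : ∀ i, ∀ z ∈ P i, ∀ k : π.ker, (extVal hH z).valuation (Θ i k - 1) < 1 → b i z = k :=
    fun i z hz k hk => (huniq i z hz).unique (hb i z hz) hk
  refine ⟨γ, hγker, hγφ, m, x, P, fun i => (hP.isClopen i).isOpen,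
    fun i z hz => (hPO i hz).1, hcov, hmeet, hPU, fun i z => (b i z : B), ?_, ?_, ?_⟩
  · exact fun i z _ => (hαπ _).1 (b i z).2
  · intro i z hz g hg
    have hgz : g • z ∈ P i := by
      have h1 : g • P i = P i := hg
      rw [← h1]
      exact Set.smul_mem_smul_set hz
    let σ₀ : U (x i) := ⟨g, hPU i hg⟩
    have hker : γ g * b i z * (γ₀ (x i) σ₀)⁻¹ ∈ π.ker := by
      rw [MonoidHom.mem_ker, hαπ, map_mul, map_mul, map_inv, hγφ, hγ₀, (hαπ _).1 (b i z).2,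
        mul_one]
      exact mul_inv_cancel _
    have h1 := hb' i (g • z) hgz ⟨_, hker⟩ (by
      have h2 := apply_comparison hu g (hp₀ (x i) σ₀) (hpγ g) (b i z)
      change (extVal hH (g • z)).valuation
        (comparison (TorsorRing.X π 1) u (p₀ (x i)) p (γ g * b i z * (γ₀ (x i) σ₀)⁻¹) - 1) < 1
      rw [← h2, ← map_one g, ← map_sub, valuation_map_smul_lt_one_iff]
      exact hb i z hz)
    exact congrArg Subtype.val h1
  · intro i z hz
    have h1 : IsOpen (⋂ k ∈ ({k | k ≠ b i z} : Set π.ker),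
        {z' | (extVal hH z').valuation (Θ i k - 1) < 1}ᶜ) :=
      (Set.toFinite _).isOpen_biInter fun k _ =>
        (isClosed_setOf_valuation_lt_one hH _).isOpen_compl
    have h2 : z ∈ ⋂ k ∈ ({k | k ≠ b i z} : Set π.ker),
        {z' | (extVal hH z').valuation (Θ i k - 1) < 1}ᶜ :=
      Set.mem_iInter₂.2 fun k hk h => hk (hb' i z hz k h).symm
    filter_upwards [h1.mem_nhds h2, (hP.isClopen i).isOpen.mem_nhds hz] with z' h3 h4
    by_contra hne
    exact Set.mem_iInter₂.1 h3 (b i z') (fun h => hne (congrArg Subtype.val h)) (hb i z' h4)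

end FieldValuationStructure

theorem theorem12p5 {K Ks X : Type*}
    [Field K] [Field Ks] [Algebra K Ks] [IsSepClosure K Ks]
    [TopologicalSpace X] [CompactSpace X] [T2Space X] [TotallyDisconnectedSpace X]
    [MulAction (Ks ≃ₐ[K] Ks) X] [ContinuousSMul (Ks ≃ₐ[K] Ks) X]
    (𝓚 : FieldValuationStructure K Ks X)
    (hproper : 𝓚.IsProper) (hhensel : 𝓚.IsHenselian)
    (hblock : 𝓚.BlockApproximationCondition) :
    𝓚.gal.IsProjective := by
  classical
  intro A I B J _ _ _ _ _ _ _ _ _ _ _ _ _ _ _ _ _ _ 𝓐 𝓑 φ α hα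
  let φ' : Gal(Ks/K) →* A := φ.onGroup
  have hφker : IsOpen (φ'.ker : Set Gal(Ks/K)) :=
    (isOpen_discrete ({1} : Set A)).preimage φ.onGroup.continuous_toFun
  let B' : Subgroup B := φ'.range.comap α.onGroup
  let α' : B' →* A := (α.onGroup : B →* A).comp B'.subtype
  have hα' : α'.range = φ'.range := by
    ext a
    constructor
    · rintro ⟨b, rfl⟩
      exact b.2
    · intro ha
      obtain ⟨b, rfl⟩ := hα.surjective_group a
      exact ⟨⟨b, ha⟩, rfl⟩
  choose j hj using fun x => hα.surjective_space (φ.onSpace x)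
  let U : X → Subgroup Gal(Ks/K) := fun x =>
    Subgroup.comap φ' (𝓐.sub (α.onSpace (j x)) : Subgroup A)
  choose γ₁ hγ₁ hγ₁φ using fun x => hα.exists_local_lift φ' (j x)
  let γ₀ : ∀ x, U x →* B' := fun x => (γ₁ x).codRestrict B' fun σ => by
    change α.onGroup (γ₁ x σ) ∈ φ'.range
    rw [hγ₁φ]
    exact ⟨_, rfl⟩
  have hγ₀ : ∀ x, ∀ σ : U x, α' (γ₀ x σ) = φ' σ := hγ₁φ
  have hγ₀ker : ∀ x, φ'.ker ≤ (γ₀ x).ker.map (U x).subtype := by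
    intro x σ hσ
    have hσ1 : φ' σ = 1 := hσ
    have hσU : σ ∈ U x := by
      change φ' σ ∈ (𝓐.sub (α.onSpace (j x)) : Subgroup A)
      rw [hσ1]
      exact one_mem _
    refine ⟨⟨σ, hσU⟩, ?_, rfl⟩
    change γ₀ x ⟨σ, hσU⟩ = 1
    refine Subtype.ext ((hα.bijOn (j x)).injOn (hγ₁ x _) (one_mem _) ?_)
    exact (hγ₁φ x _).trans (hσ1.trans (map_one _).symm)
  obtain ⟨γ, hγker, hγφ, m, x, P, hP, hPO, hcov, hmeet, hPU, b, hb, hbγ, hbloc⟩ :=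
    FieldValuationStructure.exists_global_hom hproper hhensel hblock φ' hφker α' hα'
      (fun x => {y | φ.onSpace y = φ.onSpace x})
      (fun x => (isOpen_discrete {φ.onSpace x}).preimage φ.onSpace.continuous)
      (fun x => rfl) U
      (fun x σ hσ => by
        change φ.onGroup σ ∈ (𝓐.sub (α.onSpace (j x)) : Subgroup A)
        rw [hj]
        exact φ.map_sub x σ hσ) γ₀ hγ₀ fun x => Subgroup.isOpen_mono (hγ₀ker x) hφker
  let γ' : Gal(Ks/K) →ₜ* B :=
    { B'.subtype.comp γ with
      continuous_toFun := by
        refine continuous_of_continuousAt_one (B'.subtype.comp γ) ?_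
        rw [ContinuousAt, map_one, nhds_discrete B, Filter.tendsto_pure]
        filter_upwards [hγker.mem_nhds (one_mem γ.ker)] with σ hσ
        exact congrArg Subtype.val (show γ σ = 1 from hσ) }
  refine GroupStructure.exists_hom_of_blocks hα
    (GroupStructure.IsProper.sub_eq_stabilizer hproper) γ' hγφ P hP hcov hmeet
    (fun i => j (x i)) (fun i z hz => (hPO i hz).trans (hj _).symm)
    (fun i g => if hg : g ∈ MulAction.stabilizer Gal(Ks/K) (P i) then
      (γ₀ (x i) ⟨g, hPU i hg⟩ : B) else 1) ?_ ?_ (fun i z => b i z) hb ?_ ?_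
  · intro i g hg
    rw [dif_pos hg]
    exact hγ₁ _ _
  · intro i g hg
    rw [dif_pos hg]
    exact hγ₁φ _ _
  · intro i z hz g hg
    rw [dif_pos hg]
    exact congrArg Subtype.val (hbγ i z hz g hg)
  · intro i z hz
    filter_upwards [hbloc i z hz] with z' hz'
    rw [hz']
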